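/- Let $(\Omega,\mathcal F,P)$ be a probability space, $\mathbb K\in\{\mathbb R,\mathbb C\}$, and let $L^0(\mathcal F,\mathbb K)$ be the algebra of almost-sure equivalence classes of $\mathbb K$-valued random variables. Write $L^0_+(\mathcal F)=\{\xi\in L^0(\mathcal F,\mathbb R):\xi\ge 0\}$ and $L^0_{++}(\mathcal F)=\{\xi\in L^0(\mathcal F,\mathbb R):\xi>0 \text{ almost surely}\}$. A random normed module $(S,\|\cdot\|)$ over $\mathbb K$ with base $(\Omega,\mathcal F,P)$ is a module $S$ over $L^0(\mathcal F,\mathbb K)$ with a map $\|\cdot\|:S\to L^0_+(\mathcal F)$ such that $\|x\|=0\Rightarrow x=0$, $\|\zeta x\|=|\zeta|\,\|x\|$ and $\|x+y\|\le\|x\|+\|y\|$ for all $x,y\in S$ and $\zeta\in L^0(\mathcal F,\mathbb K)$. Its $(\varepsilon,\lambda)$-topology $\mathcal T_{\varepsilon,\lambda}$ is the translation-invariant topology for which the sets $\{z\in S: P(\|z\|<\varepsilon)>1-\lambda\}$ ($\varepsilon>0$, $0<\lambda<1$) form a local base at $0$; its locally $L^0$-convex topology $\mathcal T_c$ is the translation-invariant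 topology for which the sets $\{z\in S:\|z\|<\varepsilon\text{ almost surely}\}$ ($\varepsilon\in L^0_{++}(\mathcal F)$) form a local base at $0$. In particular both topologies are defined on $L^0(\mathcal F,\mathbb R)$ with the $L^0$-norm $|\cdot|$. Real numbers are identified with constant random variables. For $g:[0,\infty)\to S$, the integral $\int_0^\infty g(s)\,ds$ is the $\mathcal T_{\varepsilon,\lambda}$-limit, as $L\to\infty$, of the Riemann integrals $\int_0^L g(s)\,ds$, each of which is the $\mathcal T_{\varepsilon,\lambda}$-limit of the Riemann sums over tagged partitions of $[0,L]$ as the mesh tends to $0$. For a function $F:L^0_{++}(\mathcal F)\to S$ and $\eta\in L^0_{++}(\mathcal F)$, the $\mathcal T_c$-derivative of $F$ at $\eta$ is the $\mathcal T_c$-limit (if it exists) of $y^{-1}(F(\eta+y)-F(\eta))$ as $y\to0$ in $\mathcal T_c$, where $y\in L^0(\mathcal F,\mathbb R)$ satisfies $|y|\in L^0_{++}(\mathcal F)$ and $\eta+y\in L^0_{++}(\mathcal F)$. Iterating, with $\mathcal T_c\text{-}F^{(0)}=F$, one obtains the derivatives $\mathcal T_c\text{-}F^{(k)}$. **Theorem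 3.5 (Post–Widder inversion).** Let $S$ be a $\mathcal T_{\varepsilon,\lambda}$-complete random normed module, and let $h:[0,\infty)\to(S,\mathcal T_{\varepsilon,\lambda})$ be a continuous function such that, for some $M\in L^0_+(\mathcal F)$, $\|h(s)\|\le M$ for all $s\ge0$. Then the Laplace transform $$H(\eta)=\int_0^\infty e^{-\eta s}h(s)\,ds$$ exists for every $\eta\in L^0_{++}(\mathcal F)$, the function $H:L^0_{++}(\mathcal F)\to S$ has $\mathcal T_c$-derivatives $\mathcal T_c\text{-}H^{(k)}$ of every order $k$ on $L^0_{++}(\mathcal F)$, and for every real $t>0$ $$\lim_{k\to\infty}(-1)^k\left(\frac kt\right)^{k+1}\frac1{k!}\;\mathcal T_c\text{-}H^{(k)}\!\left(\frac kt\right)=h(t)\qquad\text{in }(S,\mathcal T_{\varepsilon,\lambda}).$$ -/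

import Mathlib

open MeasureTheory Filter

noncomputable section

/-- Addition and multiplication of classes of random variables are those of Mathlib; the ring laws
hold because they hold pointwise. -/
instance l0CommRing {Ω : Type*} [MeasurableSpace Ω] (P : Measure Ω) (𝕜 : Type*) [RCLike 𝕜] :
    CommRing (Ω →ₘ[P] 𝕜) :=
  { AEEqFun.instAddCommGroup, AEEqFun.instCommMonoid with
    left_distrib := fun a b c => by
      apply AEEqFun.ext
      filter_upwards [AEEqFun.coeFn_mul a (b + c), AEEqFun.coeFn_add b c,
        AEEqFun.coeFn_add (a * b) (a * c), AEEqFun.coeFn_mul a b, AEEqFun.coeFn_mul a c]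
        with ω h1 h2 h3 h4 h5
      simp only [h1, h2, h3, h4, h5, Pi.mul_apply, Pi.add_apply]
      exact mul_add _ _ _
    right_distrib := fun a b c => by
      apply AEEqFun.ext
      filter_upwards [AEEqFun.coeFn_mul (a + b) c, AEEqFun.coeFn_add a b,
        AEEqFun.coeFn_add (a * c) (b * c), AEEqFun.coeFn_mul a c, AEEqFun.coeFn_mul b c]
        with ω h1 h2 h3 h4 h5
      simp only [h1, h2, h3, h4, h5, Pi.mul_apply, Pi.add_apply]
      exact add_mul _ _ _
    zero_mul := fun a => by
      apply AEEqFun.ext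
      filter_upwards [AEEqFun.coeFn_mul 0 a, AEEqFun.coeFn_zero (α := Ω) (μ := P) (β := 𝕜)]
        with ω h1 h2
      simp [h1, h2]
    mul_zero := fun a => by
      apply AEEqFun.ext
      filter_upwards [AEEqFun.coeFn_mul a 0, AEEqFun.coeFn_zero (α := Ω) (μ := P) (β := 𝕜)]
        with ω h1 h2
      simp [h1, h2] }

/-- The equivalence class of `ω ↦ |ζ ω|`, for a random variable `ζ` with values in `𝕜 = ℝ` or `ℂ`. -/
def l0Abs {Ω : Type*} [MeasurableSpace Ω] {P : Measure Ω} {𝕜 : Type*} [RCLike 𝕜]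
    (ζ : Ω →ₘ[P] 𝕜) : Ω →ₘ[P] ℝ :=
  AEEqFun.comp (fun z : 𝕜 => ‖z‖) continuous_norm ζ

/-- The inclusion of `L⁰(F, ℝ)` into `L⁰(F, 𝕜)`. -/
def l0OfReal {Ω : Type*} [MeasurableSpace Ω] {P : Measure Ω} (𝕜 : Type*) [RCLike 𝕜]
    (ζ : Ω →ₘ[P] ℝ) : Ω →ₘ[P] 𝕜 :=
  AEEqFun.comp (fun r : ℝ => (r : 𝕜)) RCLike.continuous_ofReal ζ

/-- The equivalence class of `ω ↦ (ζ ω)⁻¹`; it is the inverse of `ζ` in the algebra `L⁰(F, ℝ)`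
as soon as `ζ ≠ 0` almost surely. -/
def l0Inv {Ω : Type*} [MeasurableSpace Ω] {P : Measure Ω} (ζ : Ω →ₘ[P] ℝ) : Ω →ₘ[P] ℝ :=
  AEEqFun.compMeasurable (fun r : ℝ => r⁻¹) measurable_inv ζ

/-- The equivalence class of `ω ↦ exp (ζ ω)`. -/
def l0Exp {Ω : Type*} [MeasurableSpace Ω] {P : Measure Ω} (ζ : Ω →ₘ[P] ℝ) : Ω →ₘ[P] ℝ :=
  AEEqFun.comp Real.exp Real.continuous_exp ζ

/-- The set `L⁰₊₊(F)` of (classes of) real random variables that are positive almost surely.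
It is also the set `G₀ = {η | η > 0 on Ω}`. -/
def L0pp {Ω : Type*} [MeasurableSpace Ω] (P : Measure Ω) : Set (Ω →ₘ[P] ℝ) :=
  {ξ | ∀ᵐ ω ∂P, 0 < ξ ω}

/-- A random normed module over `𝕜` with base `(Ω, F, P)`: a module over the algebra
`L⁰(F, 𝕜)` with an `L⁰`-norm. -/
class RandomNormedModule {Ω : Type*} [MeasurableSpace Ω] (P : Measure Ω) (𝕜 : Type*) [RCLike 𝕜]
    (S : Type*) [AddCommGroup S] [Module (Ω →ₘ[P] 𝕜) S] where
  l0norm : S → (Ω →ₘ[P] ℝ)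
  l0norm_nonneg : ∀ x : S, 0 ≤ l0norm x
  eq_zero_of_l0norm : ∀ x : S, l0norm x = 0 → x = 0
  l0norm_smul : ∀ (ζ : Ω →ₘ[P] 𝕜) (x : S), l0norm (ζ • x) = l0Abs ζ * l0norm x
  l0norm_add_le : ∀ x y : S, l0norm (x + y) ≤ l0norm x + l0norm y

/-- The algebra `L⁰(F, 𝕜)` with the absolute value is a random normed module over itself. -/
instance l0RandomNormedModule {Ω : Type*} [MeasurableSpace Ω] (P : Measure Ω)
    (𝕜 : Type*) [RCLike 𝕜] : RandomNormedModule P 𝕜 (Ω →ₘ[P] 𝕜) where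
  l0norm := l0Abs
  l0norm_nonneg x := by
    rw [← AEEqFun.coeFn_le]
    filter_upwards [AEEqFun.coeFn_comp (fun z : 𝕜 => ‖z‖) continuous_norm x,
      AEEqFun.coeFn_zero (α := Ω) (μ := P) (β := ℝ)] with ω h1 h2
    rw [l0Abs, h1, h2]
    exact norm_nonneg _
  eq_zero_of_l0norm x hx := by
    apply AEEqFun.ext
    have h3 : (l0Abs x : Ω → ℝ) =ᵐ[P] (0 : Ω →ₘ[P] ℝ) := by rw [hx]
    filter_upwards [AEEqFun.coeFn_comp (fun z : 𝕜 => ‖z‖) continuous_norm x, h3,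
      AEEqFun.coeFn_zero (α := Ω) (μ := P) (β := ℝ),
      AEEqFun.coeFn_zero (α := Ω) (μ := P) (β := 𝕜)] with ω h1 h2 h4 h5
    rw [l0Abs, h1, h4] at h2
    rw [h5]
    exact norm_eq_zero.1 h2
  l0norm_smul ζ x := by
    apply AEEqFun.ext
    filter_upwards [AEEqFun.coeFn_comp (fun z : 𝕜 => ‖z‖) continuous_norm x,
      AEEqFun.coeFn_comp (fun z : 𝕜 => ‖z‖) continuous_norm ζ,
      AEEqFun.coeFn_comp (fun z : 𝕜 => ‖z‖) continuous_norm (ζ * x),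
      AEEqFun.coeFn_mul ζ x, AEEqFun.coeFn_mul (l0Abs ζ) (l0Abs x)] with ω h1 h2 h3 h4 h5
    rw [smul_eq_mul, h5, Pi.mul_apply, l0Abs, l0Abs, l0Abs, h1, h2, h3]
    simp [h4]
  l0norm_add_le x y := by
    rw [← AEEqFun.coeFn_le]
    filter_upwards [AEEqFun.coeFn_comp (fun z : 𝕜 => ‖z‖) continuous_norm x,
      AEEqFun.coeFn_comp (fun z : 𝕜 => ‖z‖) continuous_norm y,
      AEEqFun.coeFn_comp (fun z : 𝕜 => ‖z‖) continuous_norm (x + y),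
      AEEqFun.coeFn_add x y, AEEqFun.coeFn_add (l0Abs x) (l0Abs y)] with ω h1 h2 h3 h4 h5
    rw [h5, Pi.add_apply, l0Abs, l0Abs, l0Abs, h1, h2, h3]
    simp only [Function.comp_apply, h4, Pi.add_apply]
    exact norm_add_le _ _

section RandomNormedModules

variable {Ω : Type*} [MeasurableSpace Ω] (P : Measure Ω) [IsProbabilityMeasure P] (𝕜 : Type*) [RCLike 𝕜]
  {S : Type*} [AddCommGroup S] [Module (Ω →ₘ[P] 𝕜) S] [RandomNormedModule P 𝕜 S]

/-- The `L⁰`-norm of `x`. -/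
def l0norm (x : S) : Ω →ₘ[P] ℝ := RandomNormedModule.l0norm (𝕜 := 𝕜) x

/-- Multiplication of `x ∈ S` by a real random variable. -/
def l0smul (ζ : Ω →ₘ[P] ℝ) (x : S) : S := l0OfReal 𝕜 ζ • x

/-- Multiplication of `x ∈ S` by a real number, identified with a constant random variable. -/
def rsmul (c : ℝ) (x : S) : S := l0smul P 𝕜 (AEEqFun.const Ω c) x

variable (S)

/-- `U_θ(ε, l) = {z | P(‖z‖ < ε) > 1 - l}`. -/
def epsLambdaBall (ε l : ℝ) : Set S :=
  {z | 1 - l < P.real {ω | l0norm P 𝕜 z ω < ε}}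

/-- `U_θ(ε) = {z | ‖z‖ < ε almost surely}`, for a real random variable `ε`. -/
def tcBall (ε : Ω →ₘ[P] ℝ) : Set S :=
  {z | ∀ᵐ ω ∂P, l0norm P 𝕜 z ω < ε ω}

/-- The `(ε, λ)`-topology: the translation-invariant topology for which the sets `U_θ(ε, l)`,
`ε > 0`, `0 < l < 1`, form a local base at the null element. -/
@[reducible] def epsLambdaTopology : TopologicalSpace S where
  IsOpen G := ∀ x ∈ G, ∃ ε > (0 : ℝ), ∃ l > (0 : ℝ), l < 1 ∧
    ∀ z ∈ epsLambdaBall P 𝕜 S ε l, x + z ∈ G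
  isOpen_univ := fun _ _ => ⟨1, one_pos, 1 / 2, by norm_num, by norm_num, fun _ _ => trivial⟩
  isOpen_inter := by
    rintro A B hA hB x ⟨hxA, hxB⟩
    obtain ⟨ε, hε, l, hl, hl1, h⟩ := hA x hxA
    obtain ⟨ε', hε', l', hl', hl1', h'⟩ := hB x hxB
    have mono : ∀ z ∈ epsLambdaBall P 𝕜 S (min ε ε') (min l l'),
        z ∈ epsLambdaBall P 𝕜 S ε l ∧ z ∈ epsLambdaBall P 𝕜 S ε' l' := by
      intro z hz
      simp only [epsLambdaBall, Set.mem_ofPred_eq] at hz ⊢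
      have h1 : P.real {ω | l0norm P 𝕜 z ω < min ε ε'} ≤ P.real {ω | l0norm P 𝕜 z ω < ε} :=
        measureReal_mono fun ω hω => by
          rw [Set.mem_ofPred_eq] at hω ⊢
          exact hω.trans_le (min_le_left _ _)
      have h2 : P.real {ω | l0norm P 𝕜 z ω < min ε ε'} ≤ P.real {ω | l0norm P 𝕜 z ω < ε'} :=
        measureReal_mono fun ω hω => by
          rw [Set.mem_ofPred_eq] at hω ⊢
          exact hω.trans_le (min_le_right _ _)
      have h3 := min_le_left l l'
      have h4 := min_le_right l l'
      constructor <;> linarith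
    exact ⟨min ε ε', lt_min hε hε', min l l', lt_min hl hl', (min_le_left _ _).trans_lt hl1,
      fun z hz => ⟨h z (mono z hz).1, h' z (mono z hz).2⟩⟩
  isOpen_sUnion := by
    intro C hC x ⟨A, hA, hx⟩
    obtain ⟨ε, hε, l, hl, hl1, h⟩ := hC A hA x hx
    exact ⟨ε, hε, l, hl, hl1, fun z hz => ⟨A, hA, h z hz⟩⟩

/-- The locally `L⁰`-convex topology: a set `G` is open if for every `x ∈ G` there is
`ε ∈ L⁰₊₊(F)` with `x + U_θ(ε) ⊆ G`. -/
@[reducible] def tcTopology : TopologicalSpace S where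
  IsOpen G := ∀ x ∈ G, ∃ ε ∈ L0pp P, ∀ z ∈ tcBall P 𝕜 S ε, x + z ∈ G
  isOpen_univ := fun _ _ => by
    refine ⟨AEEqFun.const Ω 1, ?_, fun _ _ => trivial⟩
    filter_upwards [AEEqFun.coeFn_const (μ := P) Ω (1 : ℝ)] with ω h
    rw [h]
    exact one_pos
  isOpen_inter := by
    rintro A B hA hB x ⟨hxA, hxB⟩
    obtain ⟨ε, hε, h⟩ := hA x hxA
    obtain ⟨ε', hε', h'⟩ := hB x hxB
    refine ⟨ε ⊓ ε', ?_, fun z hz => ⟨h z ?_, h' z ?_⟩⟩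
    · filter_upwards [hε, hε', AEEqFun.coeFn_inf ε ε'] with ω h1 h2 h3
      rw [h3]
      exact lt_min h1 h2
    · filter_upwards [hz, AEEqFun.coeFn_inf ε ε'] with ω h1 h3
      rw [h3] at h1
      exact h1.trans_le inf_le_left
    · filter_upwards [hz, AEEqFun.coeFn_inf ε ε'] with ω h1 h3
      rw [h3] at h1
      exact h1.trans_le inf_le_right
  isOpen_sUnion := by
    intro C hC x ⟨A, hA, hx⟩
    obtain ⟨ε, hε, h⟩ := hC A hA x hx
    exact ⟨ε, hε, fun z hz => ⟨A, hA, h z hz⟩⟩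

/-- `S` is complete for the `(ε, λ)`-topology. As this is a metrizable linear topology, it is
enough to ask that every Cauchy sequence converges. -/
def EpsLambdaComplete : Prop :=
  ∀ u : ℕ → S,
    (∀ ε > (0 : ℝ), ∀ l > (0 : ℝ), l < 1 → ∃ N : ℕ, ∀ m ≥ N, ∀ n ≥ N,
      u m - u n ∈ epsLambdaBall P 𝕜 S ε l) →
    ∃ x : S, Tendsto u atTop (@nhds S (epsLambdaTopology P 𝕜 S) x)

variable {S}

/-- `I` is the Riemann integral of `g` over `[a, b]`: for every neighbourhood `U_θ(ε, l)` there is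
`δ > 0` such that every Riemann sum over a tagged partition `a = p 0 < p 1 < ⋯ < p n = b`,
with tags `τ i ∈ [p i, p (i + 1)]` and mesh less than `δ`, differs from `I` by an element of
`U_θ(ε, l)`. -/
def HasRiemannIntegral (g : ℝ → S) (a b : ℝ) (I : S) : Prop :=
  ∀ ε > (0 : ℝ), ∀ l > (0 : ℝ), l < 1 → ∃ δ > (0 : ℝ), ∀ (n : ℕ) (p τ : ℕ → ℝ),
    p 0 = a → p n = b →
    (∀ i < n, p i < p (i + 1) ∧ p (i + 1) - p i < δ ∧ p i ≤ τ i ∧ τ i ≤ p (i + 1)) →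
    (∑ i ∈ Finset.range n, rsmul P 𝕜 (p (i + 1) - p i) (g (τ i))) - I ∈ epsLambdaBall P 𝕜 S ε l

/-- `I = ∫₀^∞ g(s) ds`, the limit in the `(ε, λ)`-topology of the Riemann integrals over `[0, L]`
as `L → ∞`. -/
def HasImproperIntegral (g : ℝ → S) (I : S) : Prop :=
  ∃ F : ℝ → S, (∀ L > 0, HasRiemannIntegral P 𝕜 g 0 L (F L)) ∧
    Tendsto F atTop (@nhds S (epsLambdaTopology P 𝕜 S) I)

/-- `I = ∫₀^∞ e^{-ηs} h(s) ds`. -/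
def HasLaplaceTransformAt (h : ℝ → S) (η : Ω →ₘ[P] ℝ) (I : S) : Prop :=
  HasImproperIntegral P 𝕜 (fun s : ℝ => l0smul P 𝕜 (l0Exp (-(AEEqFun.const Ω s * η))) (h s)) I

open Classical in
/-- The Laplace transform `H(η) = ∫₀^∞ e^{-ηs} h(s) ds` (by convention `0` where the integral
does not exist). -/
def laplaceTransform (h : ℝ → S) (η : Ω →ₘ[P] ℝ) : S :=
  if H : ∃ I : S, HasLaplaceTransformAt P 𝕜 h η I then H.choose else 0

/-- `I` is the `T_c`-derivative at `x₀` of the function `H` with domain `G`: the difference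
quotients `(H(x₀ + y) - H(x₀)) / y` minus `I` tend to the null element in `T_c`, as `y → 0` in `T_c`
within the random variables `y` with `|y| ∈ L⁰₊₊(F)` and `x₀ + y ∈ G`. -/
def HasTcDerivAt (G : Set (Ω →ₘ[P] ℝ)) (H : (Ω →ₘ[P] ℝ) → S) (I : S) (x₀ : Ω →ₘ[P] ℝ) : Prop :=
  Tendsto (fun y : Ω →ₘ[P] ℝ => l0smul P 𝕜 (l0Inv y) (H (x₀ + y) - H x₀) - I)
    (@nhds (Ω →ₘ[P] ℝ) (tcTopology P ℝ (Ω →ₘ[P] ℝ)) 0 ⊓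
      𝓟 {y | l0Abs y ∈ L0pp P ∧ x₀ + y ∈ G})
    (@nhds S (tcTopology P 𝕜 S) 0)

open Classical in
/-- The `T_c`-derivative of `H : G → S` (by convention `0` where it does not exist). -/
def tcDeriv (G : Set (Ω →ₘ[P] ℝ)) (H : (Ω →ₘ[P] ℝ) → S) (x₀ : Ω →ₘ[P] ℝ) : S :=
  if h : ∃ I : S, HasTcDerivAt P 𝕜 G H I x₀ then h.choose else 0

/-- The `k`-th `T_c`-derivative of `H : G → S`. -/
def iterTcDeriv (G : Set (Ω →ₘ[P] ℝ)) (H : (Ω →ₘ[P] ℝ) → S) : ℕ → (Ω →ₘ[P] ℝ) → S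
  | 0 => H
  | k + 1 => tcDeriv P 𝕜 G (iterTcDeriv G H k)

end RandomNormedModules

end

/-! The `(ε, λ)`-topology is convergence in probability of the `L⁰`-norm. It need not be locally
convex, so vector integration is not directly available in `S`. The remedy is a strictly positive
random weight `w`: the elements with `E[w ‖x‖] < ∞` form a real normed space `WeightedL1`. It
inherits completeness from `S` (`WeightedL1.completeSpace`), and convergence in its norm implies
`(ε, λ)`-convergence (`WeightedL1.tendsto_val`). If an integrand is dominated by a random variable
`N`, the weight `1 / (1 + |N|)` places all its values in this space, and dominated convergence turns
continuity in probability into norm continuity (`WeightedL1.exists_continuousOn_lift`). The Bochner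
integral then supplies the Riemann and improper integrals. The weight varies with the integrand, but
improper integrals are unique in `S`, so their values do not depend on it.

The `k`-th derivative of the transform is the integral of `(-s)^k e^{-ηs} h(s)`. Convergence in
`T_c` needs almost sure bounds, which an averaged norm cannot give. They come from Riemann sums
instead: an integrand with `L⁰`-norm at most `N / (1 + s²)` has an improper integral with `L⁰`-norm
at most `N (π + 1)` (`HasImproperIntegral.l0norm_le`). Combined with the second order Taylor bound
for `exp`, this bounds the error of the difference quotient by `|y|` times a random variable
independent of `y` (`l0norm_slope_sub_le`), and a random `δ` absorbs that factor.

At the constant `k / t` the kernel is deterministic. Up to the sign `(-1)^k`, which the prefactor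
cancels, the inversion expression integrates `h` against a gamma density of shape `k + 1` and rate
`k / t`. This takes place in one Banach space, weighted through `M`, where `h` becomes continuous
and bounded. The mean squared distance of the density from `t` is `t² (1/k + 2/k²)`, so a Chebyshev
argument gives the limit (`tendsto_integral_gamma_smul`). -/

set_option linter.unusedSectionVars false

/-! ### Pointwise representatives of the operations on random variables. -/

section L0Basics

variable {Ω : Type*} [MeasurableSpace Ω] {P : Measure Ω} {𝕜 : Type*} [RCLike 𝕜]

/-- The inclusion of `L⁰(F, ℝ)` into `L⁰(F, 𝕜)` as a ring homomorphism. -/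
def l0OfRealHom (P : Measure Ω) (𝕜 : Type*) [RCLike 𝕜] : (Ω →ₘ[P] ℝ) →+* (Ω →ₘ[P] 𝕜) where
  toFun := l0OfReal 𝕜
  map_one' := by
    apply AEEqFun.ext
    filter_upwards [AEEqFun.coeFn_comp (fun r : ℝ => (r : 𝕜)) RCLike.continuous_ofReal
      (1 : Ω →ₘ[P] ℝ), AEEqFun.coeFn_one (α := Ω) (μ := P) (β := ℝ),
      AEEqFun.coeFn_one (α := Ω) (μ := P) (β := 𝕜)] with ω h1 h2 h3
    simp [l0OfReal, h1, h2, h3]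
  map_zero' := by
    apply AEEqFun.ext
    filter_upwards [AEEqFun.coeFn_comp (fun r : ℝ => (r : 𝕜)) RCLike.continuous_ofReal
      (0 : Ω →ₘ[P] ℝ), AEEqFun.coeFn_zero (α := Ω) (μ := P) (β := ℝ),
      AEEqFun.coeFn_zero (α := Ω) (μ := P) (β := 𝕜)] with ω h1 h2 h3
    simp [l0OfReal, h1, h2, h3]
  map_mul' a b := by
    apply AEEqFun.ext
    filter_upwards [AEEqFun.coeFn_comp (fun r : ℝ => (r : 𝕜)) RCLike.continuous_ofReal (a * b),
      AEEqFun.coeFn_comp (fun r : ℝ => (r : 𝕜)) RCLike.continuous_ofReal a,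
      AEEqFun.coeFn_comp (fun r : ℝ => (r : 𝕜)) RCLike.continuous_ofReal b,
      AEEqFun.coeFn_mul a b, AEEqFun.coeFn_mul (l0OfReal 𝕜 a) (l0OfReal 𝕜 b)] with ω h1 h2 h3 h4 h5
    rw [h5, Pi.mul_apply, l0OfReal, l0OfReal, l0OfReal, h1, h2, h3]
    simp [h4]
  map_add' a b := by
    apply AEEqFun.ext
    filter_upwards [AEEqFun.coeFn_comp (fun r : ℝ => (r : 𝕜)) RCLike.continuous_ofReal (a + b),
      AEEqFun.coeFn_comp (fun r : ℝ => (r : 𝕜)) RCLike.continuous_ofReal a,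
      AEEqFun.coeFn_comp (fun r : ℝ => (r : 𝕜)) RCLike.continuous_ofReal b,
      AEEqFun.coeFn_add a b, AEEqFun.coeFn_add (l0OfReal 𝕜 a) (l0OfReal 𝕜 b)] with ω h1 h2 h3 h4 h5
    rw [h5, Pi.add_apply, l0OfReal, l0OfReal, l0OfReal, h1, h2, h3]
    simp [h4]

/-- Real numbers as constant random variables. -/
def l0ConstHom (P : Measure Ω) : ℝ →+* (Ω →ₘ[P] ℝ) where
  toFun := AEEqFun.const Ω
  map_one' := rfl
  map_zero' := rfl
  map_mul' _ _ := rfl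
  map_add' _ _ := rfl

lemma coeFn_l0Abs (ζ : Ω →ₘ[P] 𝕜) : ∀ᵐ ω ∂P, l0Abs ζ ω = ‖ζ ω‖ :=
  AEEqFun.coeFn_comp _ continuous_norm ζ

lemma coeFn_l0Inv (ζ : Ω →ₘ[P] ℝ) : ∀ᵐ ω ∂P, l0Inv ζ ω = (ζ ω)⁻¹ :=
  AEEqFun.coeFn_compMeasurable _ measurable_inv ζ

lemma coeFn_l0Exp (ζ : Ω →ₘ[P] ℝ) : ∀ᵐ ω ∂P, l0Exp ζ ω = Real.exp (ζ ω) :=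
  AEEqFun.coeFn_comp _ Real.continuous_exp ζ

lemma coeFn_l0OfReal (ζ : Ω →ₘ[P] ℝ) : ∀ᵐ ω ∂P, l0OfReal 𝕜 ζ ω = (ζ ω : 𝕜) :=
  AEEqFun.coeFn_comp _ RCLike.continuous_ofReal ζ

lemma coeFn_l0const (P : Measure Ω) (c : ℝ) : ∀ᵐ ω ∂P, (AEEqFun.const Ω c : Ω →ₘ[P] ℝ) ω = c :=
  AEEqFun.coeFn_const (μ := P) Ω c

lemma l0const_mem_L0pp {c : ℝ} (hc : 0 < c) : (AEEqFun.const Ω c : Ω →ₘ[P] ℝ) ∈ L0pp P := by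
  filter_upwards [coeFn_l0const P c] with ω h
  rwa [h]

end L0Basics

/-! ### Almost sure calculus of the `L⁰`-norm and the two topologies. -/

section RandomNorm

variable {Ω : Type*} [MeasurableSpace Ω] {P : Measure Ω} [IsProbabilityMeasure P] {𝕜 : Type*}
  [RCLike 𝕜] {S : Type*} [AddCommGroup S] [Module (Ω →ₘ[P] 𝕜) S] [RandomNormedModule P 𝕜 S]

lemma l0smul_eq_hom (ζ : Ω →ₘ[P] ℝ) (x : S) : l0smul P 𝕜 ζ x = l0OfRealHom P 𝕜 ζ • x := rfl

lemma l0smul_sub (ζ : Ω →ₘ[P] ℝ) (x y : S) :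
    l0smul P 𝕜 ζ (x - y) = l0smul P 𝕜 ζ x - l0smul P 𝕜 ζ y := smul_sub _ _ _

lemma sub_l0smul (ζ ξ : Ω →ₘ[P] ℝ) (x : S) :
    l0smul P 𝕜 (ζ - ξ) x = l0smul P 𝕜 ζ x - l0smul P 𝕜 ξ x := by
  simp only [l0smul_eq_hom, map_sub, sub_smul]

lemma mul_l0smul (ζ ξ : Ω →ₘ[P] ℝ) (x : S) :
    l0smul P 𝕜 (ζ * ξ) x = l0smul P 𝕜 ζ (l0smul P 𝕜 ξ x) := by
  simp only [l0smul_eq_hom, map_mul, mul_smul]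

lemma rsmul_eq_hom (c : ℝ) (x : S) :
    rsmul P 𝕜 c x = ((l0OfRealHom P 𝕜).comp (l0ConstHom P)) c • x := rfl

lemma l0smul_rsmul (ζ : Ω →ₘ[P] ℝ) (c : ℝ) (x : S) :
    l0smul P 𝕜 ζ (rsmul P 𝕜 c x) = rsmul P 𝕜 c (l0smul P 𝕜 ζ x) := by
  rw [rsmul, rsmul, ← mul_l0smul, ← mul_l0smul, mul_comm]

variable (P 𝕜)

lemma l0norm_nonneg_ae (x : S) : ∀ᵐ ω ∂P, 0 ≤ l0norm P 𝕜 x ω := by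
  have h := RandomNormedModule.l0norm_nonneg (P := P) (𝕜 := 𝕜) x
  rw [← AEEqFun.coeFn_le] at h
  filter_upwards [h, AEEqFun.coeFn_zero (α := Ω) (μ := P) (β := ℝ)] with ω h1 h2
  rw [h2] at h1
  exact h1

lemma l0norm_add_ae (x y : S) :
    ∀ᵐ ω ∂P, l0norm P 𝕜 (x + y) ω ≤ l0norm P 𝕜 x ω + l0norm P 𝕜 y ω := by
  have h := RandomNormedModule.l0norm_add_le (P := P) (𝕜 := 𝕜) x y
  rw [← AEEqFun.coeFn_le] at h
  filter_upwards [h, AEEqFun.coeFn_add (l0norm P 𝕜 x) (l0norm P 𝕜 y)] with ω h1 h2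
  exact h1.trans_eq h2

lemma l0norm_smul_ae (ζ : Ω →ₘ[P] 𝕜) (x : S) :
    ∀ᵐ ω ∂P, l0norm P 𝕜 (ζ • x) ω = ‖ζ ω‖ * l0norm P 𝕜 x ω := by
  have h := RandomNormedModule.l0norm_smul (P := P) (𝕜 := 𝕜) ζ x
  filter_upwards [coeFn_l0Abs ζ, AEEqFun.coeFn_mul (l0Abs ζ) (l0norm P 𝕜 x)] with ω h1 h2
  rw [l0norm, h]
  exact h2.trans (by rw [Pi.mul_apply, h1])

lemma l0norm_l0smul_ae (ζ : Ω →ₘ[P] ℝ) (x : S) :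
    ∀ᵐ ω ∂P, l0norm P 𝕜 (l0smul P 𝕜 ζ x) ω = |ζ ω| * l0norm P 𝕜 x ω := by
  filter_upwards [l0norm_smul_ae P 𝕜 (l0OfReal 𝕜 ζ) x, coeFn_l0OfReal (𝕜 := 𝕜) ζ] with ω h1 h2
  rw [l0smul, h1, h2, RCLike.norm_ofReal]

lemma l0norm_rsmul_ae (c : ℝ) (x : S) :
    ∀ᵐ ω ∂P, l0norm P 𝕜 (rsmul P 𝕜 c x) ω = |c| * l0norm P 𝕜 x ω := by
  filter_upwards [l0norm_l0smul_ae P 𝕜 (AEEqFun.const Ω c) x, coeFn_l0const P c] with ω h1 h2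
  rw [rsmul, h1, h2]

lemma l0norm_zero_ae : ∀ᵐ ω ∂P, l0norm P 𝕜 (0 : S) ω = 0 := by
  filter_upwards [l0norm_rsmul_ae P 𝕜 0 (0 : S)] with ω h
  rwa [rsmul_eq_hom, smul_zero, abs_zero, zero_mul] at h

lemma l0norm_neg_ae (x : S) : ∀ᵐ ω ∂P, l0norm P 𝕜 (-x) ω = l0norm P 𝕜 x ω := by
  filter_upwards [l0norm_rsmul_ae P 𝕜 (-1) x] with ω h
  rw [rsmul_eq_hom, map_neg, map_one, neg_smul, one_smul] at h
  simpa using h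

lemma l0norm_sub_ae (x y : S) :
    ∀ᵐ ω ∂P, l0norm P 𝕜 (x - y) ω ≤ l0norm P 𝕜 x ω + l0norm P 𝕜 y ω := by
  filter_upwards [l0norm_add_ae P 𝕜 x (-y), l0norm_neg_ae P 𝕜 y] with ω h1 h2
  rwa [← sub_eq_add_neg, h2] at h1

lemma l0norm_sub_comm_ae (x y : S) :
    ∀ᵐ ω ∂P, l0norm P 𝕜 (x - y) ω = l0norm P 𝕜 (y - x) ω := by
  filter_upwards [l0norm_neg_ae P 𝕜 (x - y)] with ω h
  rw [← h, neg_sub]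

lemma l0norm_le_add_sub_ae (x y : S) :
    ∀ᵐ ω ∂P, l0norm P 𝕜 x ω ≤ l0norm P 𝕜 y ω + l0norm P 𝕜 (x - y) ω := by
  filter_upwards [l0norm_add_ae P 𝕜 y (x - y)] with ω h
  rwa [add_sub_cancel] at h

lemma l0norm_sub_le_ae (x y z : S) :
    ∀ᵐ ω ∂P, l0norm P 𝕜 (x - z) ω ≤ l0norm P 𝕜 (x - y) ω + l0norm P 𝕜 (y - z) ω := by
  filter_upwards [l0norm_add_ae P 𝕜 (x - y) (y - z)] with ω h
  rwa [sub_add_sub_cancel] at h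

lemma l0norm_sum_ae {ι : Type*} (s : Finset ι) (f : ι → S) :
    ∀ᵐ ω ∂P, l0norm P 𝕜 (∑ i ∈ s, f i) ω ≤ ∑ i ∈ s, l0norm P 𝕜 (f i) ω := by
  classical
  induction s using Finset.induction_on with
  | empty => filter_upwards [l0norm_zero_ae P 𝕜 (S := S)] with ω h using by simp [h]
  | insert a s ha ih =>
    filter_upwards [ih, l0norm_add_ae P 𝕜 (f a) (∑ i ∈ s, f i)] with ω h1 h2
    rw [Finset.sum_insert ha, Finset.sum_insert ha]
    linarith

lemma eq_zero_of_l0norm_ae {x : S} (h : ∀ᵐ ω ∂P, l0norm P 𝕜 x ω = 0) : x = 0 := by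
  refine RandomNormedModule.eq_zero_of_l0norm (P := P) (𝕜 := 𝕜) x (AEEqFun.ext ?_)
  filter_upwards [h, AEEqFun.coeFn_zero (α := Ω) (μ := P) (β := ℝ)] with ω h1 h2
  rw [h2]
  exact h1

lemma measurable_l0norm (x : S) : Measurable (l0norm P 𝕜 x) :=
  (AEEqFun.stronglyMeasurable _).measurable

variable {P 𝕜}

lemma eq_of_l0norm_sub_ae_le {x y : S}
    (h : ∀ ε > (0 : ℝ), ∀ᵐ ω ∂P, l0norm P 𝕜 (x - y) ω ≤ ε) : x = y := by
  have h' : ∀ᵐ ω ∂P, ∀ n : ℕ, l0norm P 𝕜 (x - y) ω ≤ 1 / ((n : ℝ) + 1) :=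
    ae_all_iff.2 fun n => h _ (by positivity)
  refine sub_eq_zero.1 (eq_zero_of_l0norm_ae P 𝕜 ?_)
  filter_upwards [h', l0norm_nonneg_ae P 𝕜 (x - y)] with ω h1 h2
  exact le_antisymm (ge_of_tendsto' tendsto_one_div_add_atTop_nhds_zero_nat h1) h2

/-- Passing to the complementary event turns membership into smallness of a probability, the form
suited to union bounds. -/
lemma mem_epsLambdaBall_iff {ε l : ℝ} {z : S} :
    z ∈ epsLambdaBall P 𝕜 S ε l ↔ P.real {ω | ε ≤ l0norm P 𝕜 z ω} < l := by
  have h : {ω | l0norm P 𝕜 z ω < ε} = {ω | ε ≤ l0norm P 𝕜 z ω}ᶜ := by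
    ext ω; simp
  rw [epsLambdaBall, Set.mem_ofPred_eq, h,
    probReal_compl_eq_one_sub (measurableSet_le measurable_const (measurable_l0norm P 𝕜 z))]
  constructor <;> intro h <;> linarith

lemma epsLambdaBall_of_ae_le {ε l : ℝ} {x z : S}
    (h : ∀ᵐ ω ∂P, l0norm P 𝕜 z ω ≤ l0norm P 𝕜 x ω) (hx : x ∈ epsLambdaBall P 𝕜 S ε l) :
    z ∈ epsLambdaBall P 𝕜 S ε l := by
  rw [mem_epsLambdaBall_iff] at *
  refine lt_of_le_of_lt (ENNReal.toReal_mono (measure_ne_top _ _) (measure_mono_ae ?_)) hx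
  filter_upwards [h] with ω h1 h2
  exact le_trans h2 h1

lemma epsLambdaBall_of_ae_le_add {ε l : ℝ} {x y z : S}
    (h : ∀ᵐ ω ∂P, l0norm P 𝕜 z ω ≤ l0norm P 𝕜 x ω + l0norm P 𝕜 y ω)
    (hx : x ∈ epsLambdaBall P 𝕜 S (ε / 2) (l / 2)) (hy : y ∈ epsLambdaBall P 𝕜 S (ε / 2) (l / 2)) :
    z ∈ epsLambdaBall P 𝕜 S ε l := by
  rw [mem_epsLambdaBall_iff] at *
  have h1 : P.real {ω | ε ≤ l0norm P 𝕜 z ω} ≤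
      P.real ({ω | ε / 2 ≤ l0norm P 𝕜 x ω} ∪ {ω | ε / 2 ≤ l0norm P 𝕜 y ω}) := by
    refine ENNReal.toReal_mono (measure_ne_top _ _) (measure_mono_ae ?_)
    filter_upwards [h] with ω h1 (h2 : ε ≤ _)
    by_contra h3
    have h4 := not_or.1 h3
    have h5 : l0norm P 𝕜 x ω < ε / 2 := not_le.1 h4.1
    have h6 : l0norm P 𝕜 y ω < ε / 2 := not_le.1 h4.2
    linarith
  have h2 := measureReal_union_le (μ := P) {ω | ε / 2 ≤ l0norm P 𝕜 x ω}
    {ω | ε / 2 ≤ l0norm P 𝕜 y ω}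
  linarith

lemma add_mem_epsLambdaBall {ε l : ℝ} {x y : S}
    (hx : x ∈ epsLambdaBall P 𝕜 S (ε / 2) (l / 2)) (hy : y ∈ epsLambdaBall P 𝕜 S (ε / 2) (l / 2)) :
    x + y ∈ epsLambdaBall P 𝕜 S ε l :=
  epsLambdaBall_of_ae_le_add (l0norm_add_ae P 𝕜 x y) hx hy

lemma sub_mem_epsLambdaBall {ε l : ℝ} {x y : S}
    (hx : x ∈ epsLambdaBall P 𝕜 S (ε / 2) (l / 2)) (hy : y ∈ epsLambdaBall P 𝕜 S (ε / 2) (l / 2)) :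
    x - y ∈ epsLambdaBall P 𝕜 S ε l :=
  epsLambdaBall_of_ae_le_add (l0norm_sub_ae P 𝕜 x y) hx hy

lemma zero_mem_epsLambdaBall {ε l : ℝ} (hε : 0 < ε) (hl : 0 < l) :
    (0 : S) ∈ epsLambdaBall P 𝕜 S ε l := by
  rw [mem_epsLambdaBall_iff]
  suffices h : P.real {ω | ε ≤ l0norm P 𝕜 (0 : S) ω} = 0 by rwa [h]
  rw [measureReal_eq_zero_iff]
  refine measure_mono_null_ae ?_ measure_empty
  filter_upwards [l0norm_zero_ae P 𝕜 (S := S)] with ω h1 (h2 : ε ≤ _)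
  linarith

/-- A random variable `ζ ≥ 0` is bounded outside an event of small probability. -/
lemma exists_measureReal_ge_lt (f : Ω → ℝ) (hf : Measurable f) {l : ℝ} (hl : 0 < l) :
    ∃ R > (0 : ℝ), P.real {ω | R ≤ f ω} < l := by
  have h1 : Tendsto (fun n : ℕ => P {ω | (n : ℝ) ≤ f ω}) atTop (nhds 0) := by
    have h2 := tendsto_measure_iInter_atTop (μ := P) (s := fun n : ℕ => {ω | (n : ℝ) ≤ f ω})
      (fun n => (measurableSet_le measurable_const hf).nullMeasurableSet)
      (fun m n hmn ω (hω : (n : ℝ) ≤ f ω) =>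
        show (m : ℝ) ≤ f ω from le_trans (by exact_mod_cast hmn) hω)
      ⟨0, measure_ne_top _ _⟩
    have h3 : (⋂ n : ℕ, {ω | (n : ℝ) ≤ f ω}) = ∅ := by
      ext ω
      simp only [Set.mem_iInter, Set.mem_ofPred_eq, Set.mem_empty_iff_false, iff_false, not_forall,
        not_le]
      exact exists_nat_gt _
    rwa [h3, measure_empty] at h2
  have h4 : Tendsto (fun n : ℕ => P.real {ω | (n : ℝ) ≤ f ω}) atTop (nhds 0) := by
    exact (ENNReal.tendsto_toReal ENNReal.zero_ne_top).comp h1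
  obtain ⟨n, hn, hn'⟩ := ((h4.eventually_lt_const hl).and (eventually_gt_atTop 0)).exists
  exact ⟨n, by exact_mod_cast hn', hn⟩

/-- Multiplication by a fixed random variable is `(ε, λ)`-continuous: off an event of probability
below `l / 2`, `|ζ|` is bounded by a constant `R`, and there it suffices that the norm be below `ε /
R`. -/
lemma exists_l0smul_mem_epsLambdaBall (ζ : Ω →ₘ[P] ℝ) {ε l : ℝ} (hε : 0 < ε) (hl : 0 < l) :
    ∃ ε' > (0 : ℝ), ∀ x ∈ epsLambdaBall P 𝕜 S ε' (l / 2), l0smul P 𝕜 ζ x ∈ epsLambdaBall P 𝕜 S ε l := by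
  obtain ⟨R, hR, hRl⟩ := exists_measureReal_ge_lt (P := P) (fun ω => |ζ ω|)
    ((AEEqFun.stronglyMeasurable ζ).measurable.abs) (half_pos hl)
  refine ⟨ε / R, div_pos hε hR, fun x hx => ?_⟩
  rw [mem_epsLambdaBall_iff] at *
  have h1 : P.real {ω | ε ≤ l0norm P 𝕜 (l0smul P 𝕜 ζ x) ω} ≤
      P.real ({ω | R ≤ |ζ ω|} ∪ {ω | ε / R ≤ l0norm P 𝕜 x ω}) := by
    refine ENNReal.toReal_mono (measure_ne_top _ _) (measure_mono_ae ?_)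
    filter_upwards [l0norm_l0smul_ae P 𝕜 ζ x, l0norm_nonneg_ae P 𝕜 x] with ω h1 h0 (h2 : ε ≤ _)
    by_contra h3
    have h4 := not_or.1 h3
    have h5 : |ζ ω| < R := not_le.1 h4.1
    have h6 : l0norm P 𝕜 x ω < ε / R := not_le.1 h4.2
    rw [lt_div_iff₀ hR] at h6
    rw [h1] at h2
    nlinarith
  have h2 := measureReal_union_le (μ := P) {ω | R ≤ |ζ ω|} {ω | ε / R ≤ l0norm P 𝕜 x ω}
  linarith

/-- The topology is given through its open sets, so it must be checked that balls are
neighbourhoods. The set of points having some ball around them inside `A` is open, by halving `ε`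
and `l`. -/
lemma mem_nhds_epsLambda_iff {A : Set S} {x : S} :
    A ∈ @nhds S (epsLambdaTopology P 𝕜 S) x ↔
      ∃ ε > (0 : ℝ), ∃ l > (0 : ℝ), l < 1 ∧ ∀ z ∈ epsLambdaBall P 𝕜 S ε l, x + z ∈ A := by
  let := epsLambdaTopology P 𝕜 S
  rw [mem_nhds_iff]
  constructor
  · rintro ⟨G, hGA, hG, hx⟩
    obtain ⟨ε, hε, l, hl, hl1, h⟩ := hG x hx
    exact ⟨ε, hε, l, hl, hl1, fun z hz => hGA (h z hz)⟩
  · rintro ⟨ε, hε, l, hl, hl1, h⟩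
    refine ⟨{y | ∃ ε > (0 : ℝ), ∃ l > (0 : ℝ), l < 1 ∧ ∀ z ∈ epsLambdaBall P 𝕜 S ε l, y + z ∈ A},
      ?_, ?_, ⟨ε, hε, l, hl, hl1, h⟩⟩
    · rintro y ⟨ε, hε, l, hl, hl1, h⟩
      simpa using h 0 (zero_mem_epsLambdaBall hε hl)
    · rintro y ⟨ε, hε, l, hl, hl1, h⟩
      refine ⟨ε / 2, half_pos hε, l / 2, half_pos hl, by linarith, fun z hz =>
        ⟨ε / 2, half_pos hε, l / 2, half_pos hl, by linarith, fun z' hz' => ?_⟩⟩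
      rw [add_assoc]
      exact h _ (add_mem_epsLambdaBall hz hz')

lemma tendsto_epsLambda_iff {ι : Type*} {f : Filter ι} {u : ι → S} {x : S} :
    Tendsto u f (@nhds S (epsLambdaTopology P 𝕜 S) x) ↔
      ∀ ε > (0 : ℝ), ∀ l > (0 : ℝ), l < 1 → ∀ᶠ i in f, u i - x ∈ epsLambdaBall P 𝕜 S ε l := by
  constructor
  · intro h ε hε l hl hl1
    have h1 : {y | y - x ∈ epsLambdaBall P 𝕜 S ε l} ∈ @nhds S (epsLambdaTopology P 𝕜 S) x :=
      mem_nhds_epsLambda_iff.2 ⟨ε, hε, l, hl, hl1, fun z hz => by simpa using hz⟩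
    exact h h1
  · intro h A hA
    obtain ⟨ε, hε, l, hl, hl1, hA⟩ := mem_nhds_epsLambda_iff.1 hA
    refine (h ε hε l hl hl1).mono fun i hi => ?_
    simpa using hA _ hi

/-- This identification gives access to almost surely convergent subsequences, on which the Fatou
and dominated convergence arguments rest. -/
lemma tendsto_epsLambda_iff_tendstoInMeasure {ι : Type*} {f : Filter ι} {u : ι → S} {x : S} :
    Tendsto u f (@nhds S (epsLambdaTopology P 𝕜 S) x) ↔
      TendstoInMeasure P (fun i => (l0norm P 𝕜 (u i - x) : Ω → ℝ)) f (fun _ => 0) := by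
  have key : ∀ i (ε : ℝ), P.real {ω | ε ≤ ‖l0norm P 𝕜 (u i - x) ω - 0‖} =
      P.real {ω | ε ≤ l0norm P 𝕜 (u i - x) ω} := by
    intro i ε
    refine measureReal_congr ?_
    filter_upwards [l0norm_nonneg_ae P 𝕜 (u i - x)] with ω h
    refine propext ?_
    change (ε ≤ ‖l0norm P 𝕜 (u i - x) ω - 0‖) ↔ _
    rw [sub_zero, Real.norm_eq_abs, abs_of_nonneg h]
    rfl
  rw [tendsto_epsLambda_iff, tendstoInMeasure_iff_measureReal_norm]
  simp only [key, mem_epsLambdaBall_iff]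
  constructor
  · intro h ε hε
    rw [Metric.tendsto_nhds]
    intro l hl
    -- The minimum with `1 / 2` only meets the requirement that the ball parameter be below `1`.
    filter_upwards [h ε hε (min l (1 / 2)) (by positivity)
      ((min_le_right _ _).trans_lt (by norm_num))] with i hi
    rw [Real.dist_0_eq_abs, abs_of_nonneg measureReal_nonneg]
    exact hi.trans_le (min_le_left _ _)
  · intro h ε hε l hl _
    exact (h ε hε).eventually_lt_const hl

lemma tendsto_epsLambda_unique {ι : Type*} {f : Filter ι} [f.NeBot] {u : ι → S} {x y : S}
    (hx : Tendsto u f (@nhds S (epsLambdaTopology P 𝕜 S) x))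
    (hy : Tendsto u f (@nhds S (epsLambdaTopology P 𝕜 S) y)) : x = y := by
  rw [tendsto_epsLambda_iff] at hx hy
  refine eq_of_l0norm_sub_ae_le (P := P) (𝕜 := 𝕜) fun ε hε => ?_
  have h1 : ∀ l > (0 : ℝ), l < 1 → P.real {ω | ε ≤ l0norm P 𝕜 (x - y) ω} < l := by
    intro l hl hl1
    obtain ⟨i, h1, h2⟩ := ((hx (ε / 2) (half_pos hε) (l / 2) (half_pos hl) (by linarith)).and
      (hy (ε / 2) (half_pos hε) (l / 2) (half_pos hl) (by linarith))).exists
    rw [← mem_epsLambdaBall_iff]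
    have h3 := sub_mem_epsLambdaBall h2 h1
    rwa [sub_sub_sub_cancel_left] at h3
  have h2 : P.real {ω | ε ≤ l0norm P 𝕜 (x - y) ω} = 0 := by
    refine le_antisymm (le_of_forall_pos_le_add fun l hl => ?_) measureReal_nonneg
    have := h1 (min l (1 / 2)) (by positivity) ((min_le_right _ _).trans_lt (by norm_num))
    linarith [min_le_left l (1 / 2)]
  rw [measureReal_eq_zero_iff] at h2
  have h3 : ∀ᵐ ω ∂P, ¬ (ε ≤ l0norm P 𝕜 (x - y) ω) := by
    rw [ae_iff]
    simpa using h2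
  exact h3.mono fun ω h => (not_le.1 h).le

/-- Order intervals of the `L⁰`-norm are closed in the `(ε, λ)`-topology. -/
lemma l0norm_le_of_approx {x : S} {N : Ω → ℝ}
    (h : ∀ ε > (0 : ℝ), ∀ l > (0 : ℝ), l < 1 → ∃ y : S, y - x ∈ epsLambdaBall P 𝕜 S ε l ∧
      ∀ᵐ ω ∂P, l0norm P 𝕜 y ω ≤ N ω) :
    ∀ᵐ ω ∂P, l0norm P 𝕜 x ω ≤ N ω := by
  have h1 : ∀ n : ℕ, ∀ᵐ ω ∂P, l0norm P 𝕜 x ω ≤ N ω + 1 / ((n : ℝ) + 1) := by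
    intro n
    set ε : ℝ := 1 / ((n : ℝ) + 1) with hεdef
    have hε : 0 < ε := by positivity
    have h2 : P {ω | ¬ (l0norm P 𝕜 x ω ≤ N ω + ε)} = 0 := by
      rw [← measureReal_eq_zero_iff]
      refine le_antisymm (le_of_forall_pos_le_add fun l hl => ?_) measureReal_nonneg
      obtain ⟨y, hy, hyN⟩ := h ε hε (min l (1 / 2)) (by positivity)
        ((min_le_right _ _).trans_lt (by norm_num))
      rw [mem_epsLambdaBall_iff] at hy
      have h3 : P.real {ω | ¬ (l0norm P 𝕜 x ω ≤ N ω + ε)} ≤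
          P.real {ω | ε ≤ l0norm P 𝕜 (y - x) ω} := by
        refine ENNReal.toReal_mono (measure_ne_top _ _) (measure_mono_ae ?_)
        filter_upwards [hyN, l0norm_le_add_sub_ae P 𝕜 x y, l0norm_sub_comm_ae P 𝕜 x y]
          with ω h1 h2 h3 (h4 : ¬ _)
        change ε ≤ l0norm P 𝕜 (y - x) ω
        rw [not_le] at h4
        linarith
      linarith [min_le_left l (1 / 2)]
    exact ae_iff.2 h2
  filter_upwards [ae_all_iff.2 h1] with ω h
  have h2 : Tendsto (fun n : ℕ => N ω + 1 / ((n : ℝ) + 1)) atTop (nhds (N ω + 0)) :=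
    tendsto_const_nhds.add tendsto_one_div_add_atTop_nhds_zero_nat
  rw [add_zero] at h2
  exact ge_of_tendsto' h2 h

lemma zero_mem_tcBall {ε : Ω →ₘ[P] ℝ} (hε : ε ∈ L0pp P) : (0 : S) ∈ tcBall P 𝕜 S ε := by
  filter_upwards [hε, l0norm_zero_ae P 𝕜 (S := S)] with ω h1 h2
  rwa [h2]

lemma mem_nhds_tc_iff {A : Set S} {x : S} :
    A ∈ @nhds S (tcTopology P 𝕜 S) x ↔ ∃ ε ∈ L0pp P, ∀ z ∈ tcBall P 𝕜 S ε, x + z ∈ A := by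
  let := tcTopology P 𝕜 S
  rw [mem_nhds_iff]
  constructor
  · rintro ⟨G, hGA, hG, hx⟩
    obtain ⟨ε, hε, h⟩ := hG x hx
    exact ⟨ε, hε, fun z hz => hGA (h z hz)⟩
  · rintro ⟨ε, hε, h⟩
    refine ⟨{y | y - x ∈ tcBall P 𝕜 S ε}, fun y hy => by simpa using h _ hy, ?_, ?_⟩
    · intro y hy
      -- Unlike in the `(ε, λ)` case the ball itself is open: its random radius minus the distance
      -- already used is still in `L⁰₊₊`.
      refine ⟨ε - l0norm P 𝕜 (y - x), ?_, fun z hz => ?_⟩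
      · filter_upwards [hy, AEEqFun.coeFn_sub ε (l0norm P 𝕜 (y - x))] with ω h1 h2
        rw [h2, Pi.sub_apply]
        linarith
      · have hyz : y + z - x = (y - x) + z := by abel
        filter_upwards [hz, AEEqFun.coeFn_sub ε (l0norm P 𝕜 (y - x)),
          l0norm_add_ae P 𝕜 (y - x) z] with ω h1 h2 h3
        rw [h2, Pi.sub_apply] at h1
        rw [hyz]
        linarith
    · simpa using zero_mem_tcBall hε

end RandomNorm

/-! ### Weighted `L¹` Banach spaces inside the module. -/

noncomputable section WeightedSpace

/-- A positive random variable. -/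
structure RandomWeight (Ω : Type*) [MeasurableSpace Ω] where
  toFun : Ω → ℝ
  measurable : Measurable toFun
  pos : ∀ ω, 0 < toFun ω

variable {Ω : Type*} [MeasurableSpace Ω] (P : Measure Ω) [IsProbabilityMeasure P] (𝕜 : Type*)
  [RCLike 𝕜] (S : Type*) [AddCommGroup S] [Module (Ω →ₘ[P] 𝕜) S] [RandomNormedModule P 𝕜 S]

/-- The elements `x` of `S` with `E[w ‖x‖] < ∞`. -/
def weightedL1Subgroup (w : RandomWeight Ω) : AddSubgroup S where
  carrier := {x | Integrable (fun ω => w.toFun ω * l0norm P 𝕜 x ω) P}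
  zero_mem' := by
    refine (integrable_zero Ω ℝ P).congr ?_
    filter_upwards [l0norm_zero_ae P 𝕜 (S := S)] with ω h
    rw [h, mul_zero, Pi.zero_apply]
  add_mem' {x y} hx hy := by
    refine (Integrable.add hx hy).mono'
      (w.measurable.mul (measurable_l0norm P 𝕜 _)).aestronglyMeasurable ?_
    filter_upwards [l0norm_add_ae P 𝕜 x y, l0norm_nonneg_ae P 𝕜 (x + y)] with ω h1 h2
    rw [Real.norm_of_nonneg (mul_nonneg (w.pos ω).le h2), Pi.add_apply, ← mul_add]
    exact mul_le_mul_of_nonneg_left h1 (w.pos ω).le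
  neg_mem' {x} hx := by
    refine Integrable.congr hx ?_
    filter_upwards [l0norm_neg_ae P 𝕜 x] with ω h
    rw [h]

/-- The real Banach space of all `x` in `S` with `E[w ‖x‖] < ∞`. -/
def WeightedL1 (w : RandomWeight Ω) : Type _ := weightedL1Subgroup P 𝕜 S w

variable {P 𝕜 S}

lemma mem_weightedL1Subgroup_of_le {w : RandomWeight Ω} {x : S} {f : Ω → ℝ}
    (h : ∀ᵐ ω ∂P, l0norm P 𝕜 x ω ≤ f ω) (hf : Integrable (fun ω => w.toFun ω * f ω) P) :
    x ∈ weightedL1Subgroup P 𝕜 S w := by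
  refine hf.mono' (w.measurable.mul (measurable_l0norm P 𝕜 _)).aestronglyMeasurable ?_
  filter_upwards [h, l0norm_nonneg_ae P 𝕜 x] with ω h1 h2
  rw [Real.norm_of_nonneg (mul_nonneg (w.pos ω).le h2)]
  exact mul_le_mul_of_nonneg_left h1 (w.pos ω).le

namespace WeightedL1

variable {w : RandomWeight Ω}

/-- The underlying element of `S`. -/
def val (x : WeightedL1 P 𝕜 S w) : S := Subtype.val x

/-- The element of the weighted space given by an element of `S`. -/
def mk (x : S) (hx : x ∈ weightedL1Subgroup P 𝕜 S w) : WeightedL1 P 𝕜 S w := ⟨x, hx⟩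

lemma val_mk (x : S) (hx : x ∈ weightedL1Subgroup P 𝕜 S w) : (mk x hx).val = x := rfl

lemma ext {x y : WeightedL1 P 𝕜 S w} (h : x.val = y.val) : x = y := Subtype.ext h

lemma integrable (x : WeightedL1 P 𝕜 S w) :
    Integrable (fun ω => w.toFun ω * l0norm P 𝕜 x.val ω) P := x.2

instance : AddCommGroup (WeightedL1 P 𝕜 S w) :=
  inferInstanceAs (AddCommGroup (weightedL1Subgroup P 𝕜 S w))

lemma val_add (x y : WeightedL1 P 𝕜 S w) : (x + y).val = x.val + y.val := rfl

lemma val_sub (x y : WeightedL1 P 𝕜 S w) : (x - y).val = x.val - y.val := rfl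

lemma val_zero : (0 : WeightedL1 P 𝕜 S w).val = 0 := rfl

instance : SMul ℝ (WeightedL1 P 𝕜 S w) where
  smul c x := ⟨rsmul P 𝕜 c x.val, by
    refine (x.integrable.const_mul |c|).congr ?_
    filter_upwards [l0norm_rsmul_ae P 𝕜 c x.val] with ω h
    rw [h]
    ring⟩

lemma val_smul (c : ℝ) (x : WeightedL1 P 𝕜 S w) : (c • x).val = rsmul P 𝕜 c x.val := rfl

instance : Module ℝ (WeightedL1 P 𝕜 S w) where
  one_smul x := ext (by rw [val_smul, rsmul_eq_hom, map_one, one_smul])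
  mul_smul a b x := ext (by
    simp only [val_smul, rsmul_eq_hom, map_mul, mul_smul])
  smul_zero a := ext (by rw [val_smul, rsmul_eq_hom, val_zero, smul_zero])
  smul_add a x y := ext (by simp only [val_smul, rsmul_eq_hom, val_add, smul_add])
  add_smul a b x := ext (by simp only [val_smul, rsmul_eq_hom, val_add, map_add, add_smul])
  zero_smul x := ext (by rw [val_smul, rsmul_eq_hom, map_zero, zero_smul, val_zero])

instance : Norm (WeightedL1 P 𝕜 S w) where
  norm x := ∫ ω, w.toFun ω * l0norm P 𝕜 x.val ω ∂P

lemma norm_def (x : WeightedL1 P 𝕜 S w) : ‖x‖ = ∫ ω, w.toFun ω * l0norm P 𝕜 x.val ω ∂P := rfl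

lemma weighted_nonneg_ae (w : RandomWeight Ω) (x : S) :
    ∀ᵐ ω ∂P, 0 ≤ w.toFun ω * l0norm P 𝕜 x ω :=
  (l0norm_nonneg_ae P 𝕜 x).mono fun ω h => mul_nonneg (w.pos ω).le h

lemma normCore : NormedSpace.Core ℝ (WeightedL1 P 𝕜 S w) where
  norm_nonneg x := integral_nonneg_of_ae (weighted_nonneg_ae w x.val)
  norm_smul c x := by
    rw [norm_def, norm_def, ← integral_const_mul]
    refine integral_congr_ae ?_
    filter_upwards [l0norm_rsmul_ae P 𝕜 c x.val] with ω h
    rw [val_smul, h, Real.norm_eq_abs]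
    ring
  norm_triangle x y := by
    rw [norm_def, norm_def, norm_def, ← integral_add x.integrable y.integrable]
    refine integral_mono_ae (x + y).integrable (x.integrable.add y.integrable) ?_
    filter_upwards [l0norm_add_ae P 𝕜 x.val y.val] with ω h
    rw [val_add, ← mul_add]
    exact mul_le_mul_of_nonneg_left h (w.pos ω).le
  norm_eq_zero_iff x := by
    rw [norm_def, integral_eq_zero_iff_of_nonneg_ae (weighted_nonneg_ae w x.val) x.integrable]
    constructor
    · intro h
      refine ext (eq_zero_of_l0norm_ae P 𝕜 ?_)
      filter_upwards [h] with ω h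
      exact (mul_eq_zero.1 h).resolve_left (w.pos ω).ne'
    · rintro rfl
      filter_upwards [l0norm_zero_ae P 𝕜 (S := S)] with ω h
      rw [val_zero, h, mul_zero, Pi.zero_apply]

instance : NormedAddCommGroup (WeightedL1 P 𝕜 S w) := NormedAddCommGroup.ofCore normCore

instance : NormedSpace ℝ (WeightedL1 P 𝕜 S w) := NormedSpace.ofCore normCore

/-- Convergence in `E[w ‖·‖]` implies convergence in the `(ε, λ)`-topology. -/
lemma exists_norm_lt_mem_epsLambdaBall (w : RandomWeight Ω) {ε l : ℝ} (hε : 0 < ε) (hl : 0 < l) :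
    ∃ δ > (0 : ℝ), ∀ x : WeightedL1 P 𝕜 S w, ‖x‖ < δ → x.val ∈ epsLambdaBall P 𝕜 S ε l := by
  obtain ⟨R, hR, hRl⟩ := exists_measureReal_ge_lt (P := P) (fun ω => (w.toFun ω)⁻¹)
    w.measurable.inv (half_pos hl)
  -- Where `w⁻¹ < R`, a norm of at least `ε` forces `w ‖x‖ ≥ ε / R`; Markov's inequality makes that
  -- event have probability below `l / 2`.
  refine ⟨ε / R * (l / 2), by positivity, fun x hx => ?_⟩
  rw [mem_epsLambdaBall_iff]
  have h1 : P.real {ω | ε ≤ l0norm P 𝕜 x.val ω} ≤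
      P.real ({ω | R ≤ (w.toFun ω)⁻¹} ∪ {ω | ε / R ≤ w.toFun ω * l0norm P 𝕜 x.val ω}) := by
    refine measureReal_mono fun ω (hω : ε ≤ _) => ?_
    by_contra h3
    have h4 := not_or.1 h3
    have h5 : (w.toFun ω)⁻¹ < R := not_le.1 h4.1
    have h6 : w.toFun ω * l0norm P 𝕜 x.val ω < ε / R := not_le.1 h4.2
    have hw := w.pos ω
    rw [inv_lt_iff_one_lt_mul₀ hw] at h5
    rw [lt_div_iff₀ hR] at h6
    nlinarith
  have h2 := measureReal_union_le (μ := P) {ω | R ≤ (w.toFun ω)⁻¹}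
    {ω | ε / R ≤ w.toFun ω * l0norm P 𝕜 x.val ω}
  have h3 := mul_meas_ge_le_integral_of_nonneg (weighted_nonneg_ae w x.val) x.integrable (ε / R)
  have h4 : P.real {ω | ε / R ≤ w.toFun ω * l0norm P 𝕜 x.val ω} < l / 2 := by
    have h5 := h3.trans_lt hx
    exact lt_of_mul_lt_mul_left h5 (by positivity)
  linarith

lemma tendsto_val {ι : Type*} {f : Filter ι} {u : ι → WeightedL1 P 𝕜 S w}
    {x : WeightedL1 P 𝕜 S w} (h : Tendsto u f (nhds x)) :
    Tendsto (fun i => (u i).val) f (@nhds S (epsLambdaTopology P 𝕜 S) x.val) := by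
  rw [tendsto_epsLambda_iff]
  intro ε hε l hl _
  obtain ⟨δ, hδ, hball⟩ := exists_norm_lt_mem_epsLambdaBall (P := P) (𝕜 := 𝕜) (S := S) w hε hl
  filter_upwards [(Metric.tendsto_nhds.1 h) δ hδ] with i hi
  rw [dist_eq_norm] at hi
  exact hball _ hi

/-- Reverse triangle inequality at a single sample point. The triangle inequalities are hypotheses
because they hold only almost surely and are collected over all `n` beforehand. -/
lemma tendsto_l0norm_sub_of_ae {u : ℕ → S} {x y : S} {ω : Ω}
    (h1 : ∀ n, l0norm P 𝕜 (y - x) ω ≤ l0norm P 𝕜 (y - u n) ω + l0norm P 𝕜 (u n - x) ω)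
    (h2 : ∀ n, l0norm P 𝕜 (y - u n) ω ≤ l0norm P 𝕜 (y - x) ω + l0norm P 𝕜 (u n - x) ω)
    (h : Tendsto (fun n => l0norm P 𝕜 (u n - x) ω) atTop (nhds 0)) :
    Tendsto (fun n => l0norm P 𝕜 (y - u n) ω) atTop (nhds (l0norm P 𝕜 (y - x) ω)) := by
  have h3 := (tendsto_const_nhds (x := l0norm P 𝕜 (y - x) ω)).sub h
  have h4 := (tendsto_const_nhds (x := l0norm P 𝕜 (y - x) ω)).add h
  rw [sub_zero] at h3
  rw [add_zero] at h4
  exact tendsto_of_tendsto_of_tendsto_of_le_of_le h3 h4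
    (fun n => by have := h1 n; simp only; linarith) (fun n => h2 n)

/-- Fatou's lemma for the `L⁰`-norm. -/
lemma mem_and_norm_le_of_tendsto_ae {c : ℝ} {u : ℕ → WeightedL1 P 𝕜 S w} {x : S}
    (hc : ∀ n, ‖u n‖ ≤ c)
    (h : ∀ᵐ ω ∂P, Tendsto (fun n => l0norm P 𝕜 (u n).val ω) atTop (nhds (l0norm P 𝕜 x ω))) :
    ∃ hx : x ∈ weightedL1Subgroup P 𝕜 S w, ‖mk x hx‖ ≤ c := by
  have hc0 : 0 ≤ c := (norm_nonneg _).trans (hc 0)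
  have hmeas : ∀ y : S, Measurable fun ω => ENNReal.ofReal (w.toFun ω * l0norm P 𝕜 y ω) :=
    fun y => (w.measurable.mul (measurable_l0norm P 𝕜 y)).ennreal_ofReal
  have hfatou : ∫⁻ ω, ENNReal.ofReal (w.toFun ω * l0norm P 𝕜 x ω) ∂P ≤ ENNReal.ofReal c := by
    calc ∫⁻ ω, ENNReal.ofReal (w.toFun ω * l0norm P 𝕜 x ω) ∂P
        = ∫⁻ ω, liminf (fun n => ENNReal.ofReal (w.toFun ω * l0norm P 𝕜 (u n).val ω)) atTop ∂P := by
          refine lintegral_congr_ae ?_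
          filter_upwards [h] with ω h
          exact ((ENNReal.continuous_ofReal.tendsto _).comp (h.const_mul _)).liminf_eq.symm
      _ ≤ liminf (fun n => ∫⁻ ω, ENNReal.ofReal (w.toFun ω * l0norm P 𝕜 (u n).val ω) ∂P) atTop :=
          lintegral_liminf_le fun n => hmeas _
      _ ≤ ENNReal.ofReal c := by
          refine liminf_le_of_frequently_le' (Frequently.of_forall fun n => ?_)
          rw [← ofReal_integral_eq_lintegral_ofReal (u n).integrable
            (weighted_nonneg_ae w (u n).val)]
          exact ENNReal.ofReal_le_ofReal (hc n)
  have hx : x ∈ weightedL1Subgroup P 𝕜 S w :=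
    (lintegral_ofReal_ne_top_iff_integrable
      (w.measurable.mul (measurable_l0norm P 𝕜 x)).aestronglyMeasurable
      (weighted_nonneg_ae w x)).1 (hfatou.trans_lt ENNReal.ofReal_lt_top).ne
  refine ⟨hx, ?_⟩
  rw [← ofReal_integral_eq_lintegral_ofReal hx (weighted_nonneg_ae w x)] at hfatou
  exact (ENNReal.ofReal_le_ofReal_iff hc0).1 hfatou

/-- A Cauchy sequence is Cauchy in probability, so completeness of `S` gives a limit `x`. Fatou's
lemma along an almost surely convergent subsequence puts `x` in the weighted space and makes the
convergence one in norm. -/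
lemma completeSpace (hS : EpsLambdaComplete P 𝕜 S) : CompleteSpace (WeightedL1 P 𝕜 S w) := by
  refine Metric.complete_of_cauchySeq_tendsto fun u hu => ?_
  obtain ⟨x, hx⟩ := hS (fun n => (u n).val) fun ε hε l hl _ => by
    obtain ⟨δ, hδ, hball⟩ := exists_norm_lt_mem_epsLambdaBall (P := P) (𝕜 := 𝕜) (S := S) w hε hl
    obtain ⟨N, hN⟩ := Metric.cauchySeq_iff.1 hu δ hδ
    exact ⟨N, fun m hm n hn => hball (u m - u n) (by rw [← dist_eq_norm]; exact hN m hm n hn)⟩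
  rw [tendsto_epsLambda_iff_tendstoInMeasure] at hx
  obtain ⟨ns, hns, hae⟩ := hx.exists_seq_tendsto_ae
  have key : ∀ n c, (∀ᶠ m in atTop, ‖u n - u m‖ ≤ c) →
      ∃ h : (u n).val - x ∈ weightedL1Subgroup P 𝕜 S w,
        ‖mk ((u n).val - x) h‖ ≤ c := by
    intro n c hc
    obtain ⟨m₀, hm₀⟩ := eventually_atTop.1 hc
    -- The shift by `m₀` puts every index of the subsequence in the range where the bound `c` holds.
    refine mem_and_norm_le_of_tendsto_ae (u := fun i => u n - u (ns (i + m₀)))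
      (fun i => hm₀ _ ((Nat.le_add_left _ _).trans (hns.id_le _))) ?_
    filter_upwards [hae, ae_all_iff.2 fun m => l0norm_sub_le_ae P 𝕜 (u n).val (u m).val x,
      ae_all_iff.2 fun m => l0norm_sub_le_ae P 𝕜 (u n).val x (u m).val,
      ae_all_iff.2 fun m => l0norm_sub_comm_ae P 𝕜 x (u m).val] with ω h1 h2 h3 h4
    refine tendsto_l0norm_sub_of_ae (u := fun i => (u (ns (i + m₀))).val) (fun i => h2 _)
      (fun i => ?_) (h1.comp (tendsto_add_atTop_nat m₀))
    rw [← h4]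
    exact h3 _
  have hmem : x ∈ weightedL1Subgroup P 𝕜 S w := by
    obtain ⟨N, hN⟩ := Metric.cauchySeq_iff.1 hu 1 one_pos
    obtain ⟨h, -⟩ := key N 1 (eventually_atTop.2 ⟨N, fun m hm => by
      rw [← dist_eq_norm]; exact (hN N le_rfl m hm).le⟩)
    simpa [val] using AddSubgroup.sub_mem _ (u N).2 h
  refine ⟨mk x hmem, Metric.tendsto_atTop.2 fun ε hε => ?_⟩
  obtain ⟨N, hN⟩ := Metric.cauchySeq_iff.1 hu (ε / 2) (half_pos hε)
  refine ⟨N, fun n hn => ?_⟩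
  obtain ⟨h, h'⟩ := key n (ε / 2) (eventually_atTop.2 ⟨N, fun m hm => by
      rw [← dist_eq_norm]; exact (hN n hn m hm).le⟩)
  rw [dist_eq_norm]
  exact lt_of_le_of_lt h' (half_lt_self hε)

lemma norm_le_of_ae_le {x : WeightedL1 P 𝕜 S w} {f : Ω → ℝ}
    (h : ∀ᵐ ω ∂P, l0norm P 𝕜 x.val ω ≤ f ω) (hf : Integrable (fun ω => w.toFun ω * f ω) P) :
    ‖x‖ ≤ ∫ ω, w.toFun ω * f ω ∂P :=
  integral_mono_ae x.integrable hf (h.mono fun ω h => mul_le_mul_of_nonneg_left h (w.pos ω).le)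

/-- Dominated convergence. -/
lemma tendsto_of_ae {u : ℕ → WeightedL1 P 𝕜 S w} {x : WeightedL1 P 𝕜 S w} {N : Ω → ℝ}
    (hN : Integrable (fun ω => w.toFun ω * N ω) P)
    (hdom : ∀ n, ∀ᵐ ω ∂P, l0norm P 𝕜 (u n - x).val ω ≤ N ω)
    (h : ∀ᵐ ω ∂P, Tendsto (fun n => l0norm P 𝕜 (u n - x).val ω) atTop (nhds 0)) :
    Tendsto u atTop (nhds x) := by
  rw [tendsto_iff_norm_sub_tendsto_zero]
  have := tendsto_integral_of_dominated_convergence (μ := P) (fun ω => w.toFun ω * N ω)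
    (F := fun n ω => w.toFun ω * l0norm P 𝕜 (u n - x).val ω) (f := fun _ => 0)
    (fun n => (u n - x).integrable.aestronglyMeasurable) hN (fun n => by
      filter_upwards [hdom n, weighted_nonneg_ae (P := P) (𝕜 := 𝕜) w (u n - x).val] with ω h1 h2
      rw [Real.norm_of_nonneg h2]
      exact mul_le_mul_of_nonneg_left h1 (w.pos ω).le)
    (by
      filter_upwards [h] with ω h
      simpa using h.const_mul (w.toFun ω))
  simpa [norm_def] using this

end WeightedL1

/-- A weight that makes a given random variable integrable. -/
def RandomWeight.of (N : Ω → ℝ) (hN : Measurable N) : RandomWeight Ω where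
  toFun ω := (1 + |N ω|)⁻¹
  measurable := (measurable_const.add hN.abs).inv
  pos ω := by positivity

/-- The product is bounded by `1`, and `P` is finite. -/
lemma RandomWeight.integrable_of (N : Ω → ℝ) (hN : Measurable N) :
    Integrable (fun ω => (RandomWeight.of N hN).toFun ω * N ω) P := by
  refine (integrable_const (1 : ℝ)).mono'
    ((RandomWeight.of N hN).measurable.mul hN).aestronglyMeasurable (ae_of_all _ fun ω => ?_)
  have h : 0 < 1 + |N ω| := by positivity
  rw [norm_mul, Real.norm_eq_abs, Real.norm_eq_abs, RandomWeight.of, abs_inv, abs_of_pos h,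
    inv_mul_le_iff₀ h]
  linarith

end WeightedSpace

/-! ### Riemann sums over tagged partitions. -/

section RiemannSums

lemma partition_le {n : ℕ} {p : ℕ → ℝ} (h : ∀ i < n, p i < p (i + 1)) {i j : ℕ} (hij : i ≤ j)
    (hj : j ≤ n) : p i ≤ p j := by
  induction j, hij using Nat.le_induction with
  | base => exact le_rfl
  | succ j _ ih => exact (ih (by omega)).trans (h j (by omega)).le

/-- Riemann sums of a continuous Banach space valued function converge to its integral. -/
lemma exists_riemannSum_sub_integral_lt {E : Type*} [NormedAddCommGroup E] [NormedSpace ℝ E]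
    [CompleteSpace E] {f : ℝ → E} {a b : ℝ} (hf : ContinuousOn f (Set.Icc a b)) {ε : ℝ}
    (hε : 0 < ε) :
    ∃ δ > (0 : ℝ), ∀ (n : ℕ) (p τ : ℕ → ℝ), p 0 = a → p n = b →
      (∀ i < n, p i < p (i + 1) ∧ p (i + 1) - p i < δ ∧ p i ≤ τ i ∧ τ i ≤ p (i + 1)) →
      ‖∑ i ∈ Finset.range n, (p (i + 1) - p i) • f (τ i) - ∫ x in a..b, f x‖ < ε := by
  -- A modulus `e` of uniform continuity gives total error at most `e (b - a)`; the `+ 1` avoids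
  -- division by zero and makes the final inequality strict.
  set e : ℝ := ε / (|b - a| + 1) with he
  have he0 : 0 < e := by positivity
  obtain ⟨δ, hδ, huc⟩ := Metric.uniformContinuousOn_iff.1
    (isCompact_Icc.uniformContinuousOn_of_continuous hf) e he0
  refine ⟨δ, hδ, fun n p τ hp0 hpn hp => ?_⟩
  have hmono : ∀ {i j : ℕ}, i ≤ j → j ≤ n → p i ≤ p j := fun hij hj =>
    partition_le (fun i hi => (hp i hi).1) hij hj
  have hsub : ∀ i < n, Set.Icc (p i) (p (i + 1)) ⊆ Set.Icc a b := fun i hi =>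
    Set.Icc_subset_Icc (hp0 ▸ hmono (Nat.zero_le i) hi.le) (hpn ▸ hmono (Nat.succ_le_of_lt hi) le_rfl)
  have hint : ∀ i < n, IntervalIntegrable f volume (p i) (p (i + 1)) := fun i hi =>
    ContinuousOn.intervalIntegrable_of_Icc (hp i hi).1.le (hf.mono (hsub i hi))
  have hsum := intervalIntegral.sum_integral_adjacent_intervals hint
  rw [hp0, hpn] at hsum
  rw [← hsum, ← Finset.sum_sub_distrib]
  have hterm : ∀ i ∈ Finset.range n,
      ‖(p (i + 1) - p i) • f (τ i) - ∫ x in (p i)..(p (i + 1)), f x‖ ≤ e * (p (i + 1) - p i) := by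
    intro i hi
    have hi := Finset.mem_range.1 hi
    obtain ⟨h1, h2, h3, h4⟩ := hp i hi
    rw [← intervalIntegral.integral_const, ← intervalIntegral.integral_sub
      intervalIntegrable_const (hint i hi)]
    have h5 := intervalIntegral.norm_integral_le_of_norm_le_const (a := p i) (b := p (i + 1))
      (f := fun x => f (τ i) - f x) (C := e) fun x hx => by
        rw [Set.uIoc_of_le h1.le] at hx
        rw [← dist_eq_norm]
        refine (huc _ (hsub i hi ⟨h3, h4⟩) _ (hsub i hi ⟨hx.1.le, hx.2⟩) ?_).le
        rw [Real.dist_eq, abs_lt]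
        constructor <;> linarith [hx.1, hx.2]
    rwa [abs_of_pos (sub_pos.2 h1)] at h5
  have hab : a ≤ b := by
    rw [← hp0, ← hpn]
    exact hmono (Nat.zero_le n) le_rfl
  calc _ ≤ ∑ i ∈ Finset.range n, e * (p (i + 1) - p i) :=
        (norm_sum_le _ _).trans (Finset.sum_le_sum hterm)
    _ = e * (b - a) := by
        rw [← Finset.mul_sum, Finset.sum_range_sub, hp0, hpn]
    _ < ε := by
        rw [he, div_mul_eq_mul_div, div_lt_iff₀ (by positivity)]
        have := le_abs_self (b - a)
        nlinarith

lemma exists_partition {L δ : ℝ} (hL : 0 < L) (hδ : 0 < δ) :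
    ∃ (n : ℕ) (p : ℕ → ℝ), p 0 = 0 ∧ p n = L ∧ (∀ i, 0 ≤ p i) ∧
      ∀ i < n, p i < p (i + 1) ∧ p (i + 1) - p i < δ ∧ p i ≤ p i ∧ p i ≤ p (i + 1) := by
  obtain ⟨n, hn⟩ := exists_nat_gt (L / δ)
  have hn0 : (0 : ℝ) < n := (div_pos hL hδ).trans hn
  refine ⟨n, fun i => i * (L / n), by simp, by field_simp, fun i => by positivity, fun i _ => ?_⟩
  have h1 : ((i + 1 : ℕ) : ℝ) * (L / n) - i * (L / n) = L / n := by push_cast; ring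
  have h2 : 0 < L / n := div_pos hL hn0
  have h3 : L / n < δ := by
    rw [div_lt_iff₀ hn0]
    rw [div_lt_iff₀ hδ] at hn
    linarith
  refine ⟨by linarith, by linarith, le_rfl, by linarith⟩

end RiemannSums

/-! ### Improper integrals in the module: uniqueness, bounds, existence. -/

noncomputable section ImproperIntegrals

variable {Ω : Type*} [MeasurableSpace Ω] {P : Measure Ω} [IsProbabilityMeasure P] {𝕜 : Type*}
  [RCLike 𝕜] {S : Type*} [AddCommGroup S] [Module (Ω →ₘ[P] 𝕜) S] [RandomNormedModule P 𝕜 S]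

lemma HasRiemannIntegral.unique {g : ℝ → S} {L : ℝ} (hL : 0 < L) {I I' : S}
    (h : HasRiemannIntegral P 𝕜 g 0 L I) (h' : HasRiemannIntegral P 𝕜 g 0 L I') : I = I' := by
  -- The constant family `I` has limit `I`, and also `I'`, since one fine partition has a Riemann
  -- sum close to both; uniqueness of limits concludes.
  refine tendsto_epsLambda_unique (P := P) (𝕜 := 𝕜) (f := (⊤ : Filter Unit)) (u := fun _ => I)
    (tendsto_epsLambda_iff.2 fun ε hε l hl _ => by
      rw [sub_self]; exact Eventually.of_forall fun _ => zero_mem_epsLambdaBall hε hl)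
    (tendsto_epsLambda_iff.2 fun ε hε l hl hl1 => Eventually.of_forall fun _ => ?_)
  obtain ⟨δ, hδ, hR⟩ := h (ε / 2) (half_pos hε) (l / 2) (half_pos hl) (by linarith)
  obtain ⟨δ', hδ', hR'⟩ := h' (ε / 2) (half_pos hε) (l / 2) (half_pos hl) (by linarith)
  obtain ⟨n, p, h0, hn, -, hp⟩ := exists_partition hL (lt_min hδ hδ')
  have h1 := hR n p p h0 hn fun i hi =>
    ⟨(hp i hi).1, (hp i hi).2.1.trans_le (min_le_left _ _), (hp i hi).2.2⟩
  have h2 := hR' n p p h0 hn fun i hi =>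
    ⟨(hp i hi).1, (hp i hi).2.1.trans_le (min_le_right _ _), (hp i hi).2.2⟩
  have h3 := sub_mem_epsLambdaBall h2 h1
  rwa [sub_sub_sub_cancel_left] at h3

lemma HasImproperIntegral.unique {g : ℝ → S} {I I' : S}
    (h : HasImproperIntegral P 𝕜 g I) (h' : HasImproperIntegral P 𝕜 g I') : I = I' := by
  obtain ⟨F, hF, hI⟩ := h
  obtain ⟨F', hF', hI'⟩ := h'
  refine tendsto_epsLambda_unique (P := P) (𝕜 := 𝕜) hI (hI'.congr' ?_)
  filter_upwards [eventually_gt_atTop 0] with L hL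
  exact (hF' L hL).unique hL (hF L hL)

lemma HasRiemannIntegral.sub {g g' : ℝ → S} {a b : ℝ} {I I' : S}
    (h : HasRiemannIntegral P 𝕜 g a b I) (h' : HasRiemannIntegral P 𝕜 g' a b I') :
    HasRiemannIntegral P 𝕜 (fun s => g s - g' s) a b (I - I') := by
  intro ε hε l hl hl1
  obtain ⟨δ, hδ, hR⟩ := h (ε / 2) (half_pos hε) (l / 2) (half_pos hl) (by linarith)
  obtain ⟨δ', hδ', hR'⟩ := h' (ε / 2) (half_pos hε) (l / 2) (half_pos hl) (by linarith)
  refine ⟨min δ δ', lt_min hδ hδ', fun n p τ h0 hn hp => ?_⟩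
  have h1 := hR n p τ h0 hn fun i hi =>
    ⟨(hp i hi).1, (hp i hi).2.1.trans_le (min_le_left _ _), (hp i hi).2.2⟩
  have h2 := hR' n p τ h0 hn fun i hi =>
    ⟨(hp i hi).1, (hp i hi).2.1.trans_le (min_le_right _ _), (hp i hi).2.2⟩
  have h3 := sub_mem_epsLambdaBall h1 h2
  rw [sub_sub_sub_comm, ← Finset.sum_sub_distrib] at h3
  simpa only [rsmul, l0smul_sub] using h3

lemma HasRiemannIntegral.l0smul {g : ℝ → S} {a b : ℝ} {I : S} (ζ : Ω →ₘ[P] ℝ)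
    (h : HasRiemannIntegral P 𝕜 g a b I) :
    HasRiemannIntegral P 𝕜 (fun s => l0smul P 𝕜 ζ (g s)) a b (l0smul P 𝕜 ζ I) := by
  intro ε hε l hl hl1
  obtain ⟨ε', hε', hball⟩ := exists_l0smul_mem_epsLambdaBall (P := P) (𝕜 := 𝕜) (S := S) ζ hε hl
  obtain ⟨δ, hδ, hR⟩ := h ε' hε' (l / 2) (half_pos hl) (by linarith)
  refine ⟨δ, hδ, fun n p τ h0 hn hp => ?_⟩
  have h3 := hball _ (hR n p τ h0 hn hp)
  rw [l0smul_sub, l0smul_eq_hom, Finset.smul_sum] at h3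
  simpa only [l0smul_rsmul, ← l0smul_eq_hom] using h3

lemma HasImproperIntegral.sub {g g' : ℝ → S} {I I' : S}
    (h : HasImproperIntegral P 𝕜 g I) (h' : HasImproperIntegral P 𝕜 g' I') :
    HasImproperIntegral P 𝕜 (fun s => g s - g' s) (I - I') := by
  obtain ⟨F, hF, hI⟩ := h
  obtain ⟨F', hF', hI'⟩ := h'
  refine ⟨fun L => F L - F' L, fun L hL => (hF L hL).sub (hF' L hL), ?_⟩
  rw [tendsto_epsLambda_iff] at *
  intro ε hε l hl hl1
  refine ((hI (ε / 2) (half_pos hε) (l / 2) (half_pos hl) (by linarith)).and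
    (hI' (ε / 2) (half_pos hε) (l / 2) (half_pos hl) (by linarith))).mono fun L h => ?_
  rw [sub_sub_sub_comm]
  exact sub_mem_epsLambdaBall h.1 h.2

lemma HasImproperIntegral.l0smul {g : ℝ → S} {I : S} (ζ : Ω →ₘ[P] ℝ)
    (h : HasImproperIntegral P 𝕜 g I) :
    HasImproperIntegral P 𝕜 (fun s => l0smul P 𝕜 ζ (g s)) (l0smul P 𝕜 ζ I) := by
  obtain ⟨F, hF, hI⟩ := h
  refine ⟨fun L => _root_.l0smul P 𝕜 ζ (F L), fun L hL => (hF L hL).l0smul ζ, ?_⟩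
  rw [tendsto_epsLambda_iff] at *
  intro ε hε l hl hl1
  obtain ⟨ε', hε', hball⟩ := exists_l0smul_mem_epsLambdaBall (P := P) (𝕜 := 𝕜) (S := S) ζ hε hl
  refine (hI ε' hε' (l / 2) (half_pos hl) (by linarith)).mono fun L h => ?_
  rw [← l0smul_sub]
  exact hball _ h

/-- The deterministic integrable profile that dominates all integrands. -/
def decayProfile (s : ℝ) : ℝ := (1 + s ^ 2)⁻¹

lemma decayProfile_pos (s : ℝ) : 0 < decayProfile s := by
  rw [decayProfile]; positivity

lemma decayProfile_le_one (s : ℝ) : decayProfile s ≤ 1 :=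
  inv_le_one_of_one_le₀ (by nlinarith [sq_nonneg s])

lemma continuous_decayProfile : Continuous decayProfile :=
  (by fun_prop : Continuous fun s : ℝ => 1 + s ^ 2).inv₀ fun s => by positivity

lemma integrable_decayProfile : Integrable decayProfile := integrable_inv_one_add_sq

lemma intervalIntegral_decayProfile_le {L : ℝ} (hL : 0 < L) :
    ∫ s in (0 : ℝ)..L, decayProfile s ≤ Real.pi := by
  rw [intervalIntegral.integral_of_le hL.le, ← integral_univ_inv_one_add_sq]
  exact setIntegral_le_integral integrable_decayProfile
    (ae_of_all _ fun s => (decayProfile_pos s).le)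

/-- An improper integral inherits an `L⁰`-bound from its integrand. -/
lemma HasImproperIntegral.l0norm_le {g : ℝ → S} {I : S} (h : HasImproperIntegral P 𝕜 g I)
    {N : Ω → ℝ} (hN : ∀ s, 0 ≤ s → ∀ᵐ ω ∂P, l0norm P 𝕜 (g s) ω ≤ N ω * decayProfile s) :
    ∀ᵐ ω ∂P, l0norm P 𝕜 I ω ≤ N ω * (Real.pi + 1) := by
  obtain ⟨F, hF, hI⟩ := h
  have hN0 : ∀ᵐ ω ∂P, 0 ≤ N ω := by
    filter_upwards [hN 0 le_rfl, l0norm_nonneg_ae P 𝕜 (g 0)] with ω h1 h2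
    exact nonneg_of_mul_nonneg_left (h2.trans h1) (decayProfile_pos 0)
  have hFL : ∀ L > 0, ∀ᵐ ω ∂P, l0norm P 𝕜 (F L) ω ≤ N ω * (Real.pi + 1) := by
    intro L hL
    refine l0norm_le_of_approx fun ε hε l hl hl1 => ?_
    obtain ⟨δ, hδ, hR⟩ := hF L hL ε hε l hl hl1
    obtain ⟨δ', hδ', hR'⟩ := exists_riemannSum_sub_integral_lt (a := 0) (b := L)
      continuous_decayProfile.continuousOn one_pos
    obtain ⟨n, p, h0, hn, hp0, hp⟩ := exists_partition hL (lt_min hδ hδ')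
    refine ⟨_, hR n p p h0 hn fun i hi =>
      ⟨(hp i hi).1, (hp i hi).2.1.trans_le (min_le_left _ _), (hp i hi).2.2⟩, ?_⟩
    have h2 := hR' n p p h0 hn fun i hi =>
      ⟨(hp i hi).1, (hp i hi).2.1.trans_le (min_le_right _ _), (hp i hi).2.2⟩
    -- The integral of the profile over `[0, L]` is at most `π`; the extra `1` pays for the error of
    -- its Riemann sum.
    have h3 : ∑ i ∈ Finset.range n, (p (i + 1) - p i) * decayProfile (p i) ≤ Real.pi + 1 := by
      have h4 := (abs_lt.1 h2).2
      simp only [smul_eq_mul] at h4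
      linarith [intervalIntegral_decayProfile_le hL]
    filter_upwards [hN0, l0norm_sum_ae P 𝕜 (Finset.range n)
      (fun i => rsmul P 𝕜 (p (i + 1) - p i) (g (p i))),
      ae_all_iff.2 fun i => l0norm_rsmul_ae P 𝕜 (p (i + 1) - p i) (g (p i)),
      ae_all_iff.2 fun i => hN (p i) (hp0 i)] with ω h4 h5 h6 h7
    refine h5.trans (le_trans ?_ (mul_le_mul_of_nonneg_left h3 h4))
    rw [Finset.mul_sum]
    refine Finset.sum_le_sum fun i hi => ?_
    have h8 := sub_pos.2 (hp i (Finset.mem_range.1 hi)).1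
    rw [h6, abs_of_pos h8, mul_left_comm]
    exact mul_le_mul_of_nonneg_left (h7 i) h8.le
  refine l0norm_le_of_approx fun ε hε l hl hl1 => ?_
  obtain ⟨L, h1, h2⟩ := ((tendsto_epsLambda_iff.1 hI ε hε l hl hl1).and
    (eventually_gt_atTop 0)).exists
  exact ⟨F L, h1, hFL L h2⟩

namespace WeightedL1

variable {w : RandomWeight Ω}

lemma val_sum {ι : Type*} (s : Finset ι) (f : ι → WeightedL1 P 𝕜 S w) :
    (∑ i ∈ s, f i).val = ∑ i ∈ s, (f i).val :=
  map_sum ({ toFun := val, map_zero' := val_zero, map_add' := val_add } :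
    WeightedL1 P 𝕜 S w →+ S) f s

lemma hasRiemannIntegral (hS : EpsLambdaComplete P 𝕜 S) {G : ℝ → WeightedL1 P 𝕜 S w} {g : ℝ → S}
    (hG : ContinuousOn G (Set.Ici 0)) (hg : ∀ s, 0 ≤ s → (G s).val = g s) (L : ℝ) :
    HasRiemannIntegral P 𝕜 g 0 L (∫ s in (0 : ℝ)..L, G s).val := by
  have := completeSpace (w := w) hS
  intro ε hε l hl _
  obtain ⟨ρ, hρ, hball⟩ := exists_norm_lt_mem_epsLambdaBall (P := P) (𝕜 := 𝕜) (S := S) w hε hl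
  obtain ⟨δ, hδ, hR⟩ := exists_riemannSum_sub_integral_lt
    (hG.mono (Set.Icc_subset_Ici_self : Set.Icc 0 L ⊆ _)) hρ
  refine ⟨δ, hδ, fun n p τ h0 hn hp => ?_⟩
  have h1 := hball _ (hR n p τ h0 hn hp)
  rw [val_sub, val_sum] at h1
  convert h1 using 2
  refine Finset.sum_congr rfl fun i hi => ?_
  have hi := Finset.mem_range.1 hi
  have h2 := partition_le (fun i hi => (hp i hi).1) (Nat.zero_le i) hi.le
  rw [val_smul, hg _ (h0 ▸ h2.trans (hp i hi).2.2.1)]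

lemma hasImproperIntegral (hS : EpsLambdaComplete P 𝕜 S) {G : ℝ → WeightedL1 P 𝕜 S w}
    {g : ℝ → S} (hG : ContinuousOn G (Set.Ici 0)) (hg : ∀ s, 0 ≤ s → (G s).val = g s)
    (hint : IntegrableOn G (Set.Ioi 0)) :
    HasImproperIntegral P 𝕜 g (∫ s in Set.Ioi (0 : ℝ), G s).val :=
  ⟨fun L => (∫ s in (0 : ℝ)..L, G s).val, fun L _ => hasRiemannIntegral hS hG hg L,
    tendsto_val (intervalIntegral_tendsto_integral_Ioi 0 hint tendsto_id)⟩

/-- A function that is continuous for the `(ε, λ)`-topology, multiplied by a random kernel with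
continuous paths, is continuous for a weighted `L¹`-norm, if it is dominated. -/
lemma exists_continuousOn_lift {h : ℝ → S}
    (hcont : @ContinuousOn ℝ S _ (epsLambdaTopology P 𝕜 S) h (Set.Ici 0))
    {κ : ℝ → Ω →ₘ[P] ℝ} {k : ℝ → Ω → ℝ} (hk : ∀ ω, Continuous fun s => k s ω)
    (hκ : ∀ s, ∀ᵐ ω ∂P, κ s ω = k s ω) {N : Ω → ℝ}
    (hN : Integrable (fun ω => w.toFun ω * N ω) P)
    (hdom : ∀ s, 0 ≤ s → ∀ᵐ ω ∂P, l0norm P 𝕜 (l0smul P 𝕜 (κ s) (h s)) ω ≤ N ω) :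
    ∃ G : ℝ → WeightedL1 P 𝕜 S w, ContinuousOn G (Set.Ici 0) ∧
      ∀ s, 0 ≤ s → (G s).val = l0smul P 𝕜 (κ s) (h s) := by
  classical
  set G : ℝ → WeightedL1 P 𝕜 S w := fun s =>
    if hs : 0 ≤ s then mk (l0smul P 𝕜 (κ s) (h s)) (mem_weightedL1Subgroup_of_le (hdom s hs) hN)
    else 0 with hGdef
  have hG : ∀ s, 0 ≤ s → (G s).val = l0smul P 𝕜 (κ s) (h s) := fun s hs => by
    simp only [hGdef, dif_pos hs, val_mk]
  -- Continuity is tested on sequences: each has a subsequence along which `h` converges almost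
  -- surely, and dominated convergence applies to that subsequence.
  refine ⟨G, fun s₀ hs₀ => tendsto_of_subseq_tendsto fun ns hns => ?_, hG⟩
  have hs₀ : 0 ≤ s₀ := hs₀
  obtain ⟨n₀, hn₀⟩ := eventually_atTop.1 (tendsto_nhdsWithin_iff.1 hns).2
  have hv : Tendsto (fun n => ns (n + n₀)) atTop (nhdsWithin s₀ (Set.Ici 0)) :=
    hns.comp (tendsto_add_atTop_nat n₀)
  have hm : TendstoInMeasure P (fun n => (l0norm P 𝕜 (h (ns (n + n₀)) - h s₀) : Ω → ℝ)) atTop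
      (fun _ => 0) := by
    rw [← tendsto_epsLambda_iff_tendstoInMeasure]
    exact Tendsto.comp (hcont s₀ hs₀) hv
  obtain ⟨φ, hφ, hae⟩ := hm.exists_seq_tendsto_ae
  refine ⟨fun n => φ n + n₀, ?_⟩
  have hpos : ∀ n, 0 ≤ ns (φ n + n₀) := fun n => hn₀ _ (Nat.le_add_left _ _)
  have hlim : Tendsto (fun n => ns (φ n + n₀)) atTop (nhds s₀) :=
    (tendsto_nhdsWithin_iff.1 (hv.comp hφ.tendsto_atTop)).1
  refine tendsto_of_ae (N := fun ω => N ω + N ω) (by simp only [mul_add]; exact hN.add hN)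
    (fun n => ?_) ?_
  · filter_upwards [hdom _ (hpos n), hdom _ hs₀,
      l0norm_sub_ae P 𝕜 (l0smul P 𝕜 (κ (ns (φ n + n₀))) (h (ns (φ n + n₀))))
        (l0smul P 𝕜 (κ s₀) (h s₀))] with ω h1 h2 h3
    rw [val_sub, hG _ (hpos n), hG _ hs₀]
    linarith
  -- The increment is split as `κ s (h s - h s₀) + (κ s - κ s₀) h s₀`: the first term tends to zero
  -- by the choice of subsequence, the second by continuity of the kernel's paths.
  · have hsplit : ∀ n, ∀ᵐ ω ∂P, l0norm P 𝕜 (G (ns (φ n + n₀)) - G s₀).val ω ≤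
        |k (ns (φ n + n₀)) ω| * l0norm P 𝕜 (h (ns (φ n + n₀)) - h s₀) ω +
        |k (ns (φ n + n₀)) ω - k s₀ ω| * l0norm P 𝕜 (h s₀) ω := by
      intro n
      set s := ns (φ n + n₀)
      filter_upwards [l0norm_add_ae P 𝕜 (l0smul P 𝕜 (κ s) (h s - h s₀))
        (l0smul P 𝕜 (κ s - κ s₀) (h s₀)), l0norm_l0smul_ae P 𝕜 (κ s) (h s - h s₀),
        l0norm_l0smul_ae P 𝕜 (κ s - κ s₀) (h s₀), hκ s, hκ s₀,
        AEEqFun.coeFn_sub (κ s) (κ s₀)] with ω h1 h2 h3 h4 h5 h6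
      rw [h2, h3, h6, Pi.sub_apply, h4, h5, l0smul_sub, sub_l0smul, sub_add_sub_cancel] at h1
      rw [val_sub, hG s (hpos n), hG s₀ hs₀]
      exact h1
    filter_upwards [hae, ae_all_iff.2 hsplit, ae_all_iff.2 fun n =>
      l0norm_nonneg_ae P 𝕜 (G (ns (φ n + n₀)) - G s₀).val] with ω h1 h2 h3
    have h4 : Tendsto (fun n => k (ns (φ n + n₀)) ω) atTop (nhds (k s₀ ω)) :=
      ((hk ω).tendsto s₀).comp hlim
    have h5 := (h4.abs.mul h1).add
      (((h4.sub_const (k s₀ ω)).abs).mul_const (l0norm P 𝕜 (h s₀) ω))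
    rw [mul_zero, sub_self, abs_zero, zero_mul, add_zero] at h5
    exact squeeze_zero h3 h2 h5

/-- The weighted norm of `G s` is at most `E[w N]` times the profile, which is integrable on the
half-line. -/
lemma integrableOn_of_dominated {G : ℝ → WeightedL1 P 𝕜 S w} (hG : ContinuousOn G (Set.Ici 0))
    {N : Ω → ℝ} (hN : Integrable (fun ω => w.toFun ω * N ω) P)
    (hdom : ∀ s, 0 ≤ s → ∀ᵐ ω ∂P, l0norm P 𝕜 (G s).val ω ≤ N ω * decayProfile s) :
    IntegrableOn G (Set.Ioi 0) := by
  have hmeas : AEStronglyMeasurable G (volume.restrict (Set.Ioi 0)) :=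
    (hG.mono Set.Ioi_subset_Ici_self).aestronglyMeasurable measurableSet_Ioi
  refine Integrable.mono' ((integrable_decayProfile.const_mul
    (∫ ω, w.toFun ω * N ω ∂P)).integrableOn (s := Set.Ioi 0)) hmeas ?_
  filter_upwards [ae_restrict_mem measurableSet_Ioi] with s hs
  have h1 := norm_le_of_ae_le (hdom s (le_of_lt hs)) (by
    simpa only [mul_assoc] using hN.mul_const (decayProfile s))
  simpa only [← mul_assoc, integral_mul_const] using h1

end WeightedL1

/-- Existence of improper integrals of dominated integrands. -/
lemma exists_hasImproperIntegral (hS : EpsLambdaComplete P 𝕜 S) {h : ℝ → S}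
    (hcont : @ContinuousOn ℝ S _ (epsLambdaTopology P 𝕜 S) h (Set.Ici 0))
    {κ : ℝ → Ω →ₘ[P] ℝ} {k : ℝ → Ω → ℝ} (hk : ∀ ω, Continuous fun s => k s ω)
    (hκ : ∀ s, ∀ᵐ ω ∂P, κ s ω = k s ω) {N : Ω → ℝ} (hN : Measurable N)
    (hdom : ∀ s, 0 ≤ s →
      ∀ᵐ ω ∂P, l0norm P 𝕜 (l0smul P 𝕜 (κ s) (h s)) ω ≤ N ω * decayProfile s) :
    ∃ I : S, HasImproperIntegral P 𝕜 (fun s => l0smul P 𝕜 (κ s) (h s)) I := by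
  have hN0 : ∀ᵐ ω ∂P, 0 ≤ N ω := by
    filter_upwards [hdom 0 le_rfl, l0norm_nonneg_ae P 𝕜 (l0smul P 𝕜 (κ 0) (h 0))] with ω h1 h2
    exact nonneg_of_mul_nonneg_left (h2.trans h1) (decayProfile_pos 0)
  -- The weight is built from the bound of this particular integrand. No common weight is needed,
  -- since the integral obtained is an element of `S`.
  obtain ⟨G, hG, hGv⟩ := WeightedL1.exists_continuousOn_lift (w := RandomWeight.of N hN) hcont hk hκ
    (RandomWeight.integrable_of N hN) fun s hs => by
      filter_upwards [hdom s hs, hN0] with ω h1 h2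
      exact h1.trans (mul_le_of_le_one_right h2 (decayProfile_le_one s))
  exact ⟨_, WeightedL1.hasImproperIntegral hS hG hGv (WeightedL1.integrableOn_of_dominated hG
    (RandomWeight.integrable_of N hN) fun s hs => by rw [hGv s hs]; exact hdom s hs)⟩

end ImproperIntegrals

/-! ### Scalar estimates for the Laplace kernel. -/

noncomputable section KernelEstimates

/-- A bound for `s ^ m * exp (-a s)` relative to the decay profile. -/
def decayBound (m : ℕ) (a : ℝ) : ℝ := m.factorial / a ^ m + (m + 2).factorial / a ^ (m + 2)

lemma measurable_decayBound (m : ℕ) : Measurable (decayBound m) := by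
  unfold decayBound
  fun_prop

lemma decayBound_nonneg (m : ℕ) {a : ℝ} (ha : 0 < a) : 0 ≤ decayBound m a := by
  unfold decayBound
  positivity

/-- The exponential `exp (s a)` dominates the `m`-th term of its power series. -/
lemma pow_mul_exp_neg_le (m : ℕ) {a s : ℝ} (ha : 0 < a) (hs : 0 ≤ s) :
    s ^ m * Real.exp (-(s * a)) ≤ m.factorial / a ^ m := by
  have h := Real.pow_div_factorial_le_exp _ (mul_nonneg hs ha.le) m
  have hm : (0 : ℝ) < m.factorial := by exact_mod_cast m.factorial_pos
  rw [div_le_iff₀ hm, mul_pow] at h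
  rw [le_div_iff₀ (pow_pos ha m), Real.exp_neg]
  have he := Real.exp_pos (s * a)
  calc s ^ m * (Real.exp (s * a))⁻¹ * a ^ m = (s ^ m * a ^ m) * (Real.exp (s * a))⁻¹ := by ring
    _ ≤ (Real.exp (s * a) * m.factorial) * (Real.exp (s * a))⁻¹ :=
        mul_le_mul_of_nonneg_right h (inv_nonneg.2 he.le)
    _ = m.factorial := by field_simp

/-- Multiplying by `1 + s²` produces the powers `m` and `m + 2`, which account for the two terms of
`decayBound`. -/
lemma pow_mul_exp_neg_le_decayProfile (m : ℕ) {a s : ℝ} (ha : 0 < a) (hs : 0 ≤ s) :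
    s ^ m * Real.exp (-(s * a)) ≤ decayBound m a * decayProfile s := by
  have h1 := pow_mul_exp_neg_le m ha hs
  have h2 := pow_mul_exp_neg_le (m + 2) ha hs
  rw [decayProfile, ← div_eq_mul_inv, le_div_iff₀ (by positivity), decayBound]
  calc s ^ m * Real.exp (-(s * a)) * (1 + s ^ 2)
      = s ^ m * Real.exp (-(s * a)) + s ^ (m + 2) * Real.exp (-(s * a)) := by ring
    _ ≤ _ := add_le_add h1 h2

lemma abs_exp_sub_one_sub_id_le_sq_mul_exp (x : ℝ) :
    |Real.exp x - 1 - x| ≤ |x| ^ 2 * Real.exp |x| := by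
  have h := Complex.norm_exp_sub_sum_le_norm_mul_exp (x : ℂ) 2
  simp only [Finset.sum_range_succ, Finset.sum_range_zero] at h
  rw [Complex.norm_real, Real.norm_eq_abs] at h
  rw [← Real.norm_eq_abs (_ - _), ← Complex.norm_real]
  refine le_trans (le_of_eq ?_) h
  congr 1
  push_cast
  simp
  ring

/-- After factoring out `exp (-s a)`, what remains is the second order Taylor remainder of `exp` at
`-s y`, divided by `y`. Its quadratic bound leaves one factor `|y|`, and the growth `exp (s |y|)`
uses up at most half of the decay rate `a`. -/
lemma abs_slope_exp_kernel_sub_le (k : ℕ) {a y s : ℝ} (hy : y ≠ 0)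
    (hya : |y| ≤ a / 2) (hs : 0 ≤ s) :
    |y⁻¹ * ((-s) ^ k * Real.exp (-(s * (a + y))) - (-s) ^ k * Real.exp (-(s * a))) -
      (-s) ^ (k + 1) * Real.exp (-(s * a))| ≤ |y| * (s ^ (k + 2) * Real.exp (-(s * (a / 2)))) := by
  have h1 : y⁻¹ * ((-s) ^ k * Real.exp (-(s * (a + y))) - (-s) ^ k * Real.exp (-(s * a))) -
      (-s) ^ (k + 1) * Real.exp (-(s * a)) =
      (-s) ^ k * Real.exp (-(s * a)) * y⁻¹ * (Real.exp (-(s * y)) - 1 - -(s * y)) := by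
    have h2 : Real.exp (-(s * (a + y))) = Real.exp (-(s * a)) * Real.exp (-(s * y)) := by
      rw [← Real.exp_add]; congr 1; ring
    rw [h2]
    field_simp
    ring
  have h2 := abs_exp_sub_one_sub_id_le_sq_mul_exp (-(s * y))
  have h3 : |-(s * y)| = s * |y| := by rw [abs_neg, abs_mul, abs_of_nonneg hs]
  have hy0 : 0 < |y| := abs_pos.2 hy
  rw [h3] at h2
  rw [h1, abs_mul, abs_mul, abs_mul, abs_pow, abs_neg, abs_of_nonneg hs, abs_inv, Real.abs_exp]
  calc s ^ k * Real.exp (-(s * a)) * |y|⁻¹ * |Real.exp (-(s * y)) - 1 - -(s * y)|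
      ≤ s ^ k * Real.exp (-(s * a)) * |y|⁻¹ * ((s * |y|) ^ 2 * Real.exp (s * |y|)) :=
        mul_le_mul_of_nonneg_left h2 (by positivity)
    _ = |y| * (s ^ (k + 2) * (Real.exp (-(s * a)) * Real.exp (s * |y|))) := by
        field_simp
        ring
    _ ≤ |y| * (s ^ (k + 2) * Real.exp (-(s * (a / 2)))) := by
        refine mul_le_mul_of_nonneg_left (mul_le_mul_of_nonneg_left ?_ (by positivity)) hy0.le
        rw [← Real.exp_add]
        refine Real.exp_le_exp.2 ?_
        nlinarith [mul_le_mul_of_nonneg_left hya hs]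

end KernelEstimates

/-! ### Differentiation of the Laplace transform in `T_c`. -/

noncomputable section LaplaceDerivatives

variable {Ω : Type*} [MeasurableSpace Ω] {P : Measure Ω} [IsProbabilityMeasure P] {𝕜 : Type*}
  [RCLike 𝕜] {S : Type*} [AddCommGroup S] [Module (Ω →ₘ[P] 𝕜) S] [RandomNormedModule P 𝕜 S]

/-- The random variable `(-s) ^ k e^{-η s}`. -/
def laplaceKernel (k : ℕ) (η : Ω →ₘ[P] ℝ) (s : ℝ) : Ω →ₘ[P] ℝ :=
  AEEqFun.const Ω ((-s) ^ k) * l0Exp (-(AEEqFun.const Ω s * η))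

lemma laplaceKernel_zero (η : Ω →ₘ[P] ℝ) (s : ℝ) :
    laplaceKernel 0 η s = l0Exp (-(AEEqFun.const Ω s * η)) := by
  rw [laplaceKernel, pow_zero]
  exact one_mul _

lemma coeFn_laplaceKernel (k : ℕ) (η : Ω →ₘ[P] ℝ) (s : ℝ) :
    ∀ᵐ ω ∂P, laplaceKernel k η s ω = (-s) ^ k * Real.exp (-(s * η ω)) := by
  filter_upwards [AEEqFun.coeFn_mul (AEEqFun.const Ω ((-s) ^ k) : Ω →ₘ[P] ℝ)
    (l0Exp (-(AEEqFun.const Ω s * η))), coeFn_l0const P ((-s) ^ k),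
    coeFn_l0Exp (-(AEEqFun.const Ω s * η)), AEEqFun.coeFn_neg (AEEqFun.const Ω s * η),
    AEEqFun.coeFn_mul (AEEqFun.const Ω s) η, coeFn_l0const P s] with ω h1 h2 h3 h4 h5 h6
  rw [laplaceKernel, h1, Pi.mul_apply, h2, h3, h4, Pi.neg_apply, h5, Pi.mul_apply, h6]

lemma continuous_laplaceKernel_path (k : ℕ) (a : ℝ) :
    Continuous fun s : ℝ => (-s) ^ k * Real.exp (-(s * a)) := by
  fun_prop

lemma laplaceKernel_dominated {h : ℝ → S} {M : Ω → ℝ}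
    (hb : ∀ s, 0 ≤ s → ∀ᵐ ω ∂P, l0norm P 𝕜 (h s) ω ≤ M ω) (k : ℕ) {η : Ω →ₘ[P] ℝ}
    (hη : η ∈ L0pp P) (s : ℝ) (hs : 0 ≤ s) :
    ∀ᵐ ω ∂P, l0norm P 𝕜 (l0smul P 𝕜 (laplaceKernel k η s) (h s)) ω ≤
      decayBound k (η ω) * M ω * decayProfile s := by
  filter_upwards [hb s hs, hη, l0norm_l0smul_ae P 𝕜 (laplaceKernel k η s) (h s),
    coeFn_laplaceKernel k η s, l0norm_nonneg_ae P 𝕜 (h s)] with ω h1 h2 h3 h4 h5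
  rw [h3, h4, abs_mul, abs_pow, abs_neg, abs_of_nonneg hs, Real.abs_exp, mul_right_comm (decayBound k _)]
  exact mul_le_mul (pow_mul_exp_neg_le_decayProfile k h2 hs) h1 h5
    (mul_nonneg (decayBound_nonneg k h2) (decayProfile_pos s).le)

lemma exists_hasImproperIntegral_laplaceKernel (hS : EpsLambdaComplete P 𝕜 S) {h : ℝ → S}
    (hcont : @ContinuousOn ℝ S _ (epsLambdaTopology P 𝕜 S) h (Set.Ici 0)) {M : Ω → ℝ}
    (hM : Measurable M) (hb : ∀ s, 0 ≤ s → ∀ᵐ ω ∂P, l0norm P 𝕜 (h s) ω ≤ M ω) (k : ℕ)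
    {η : Ω →ₘ[P] ℝ} (hη : η ∈ L0pp P) :
    ∃ I : S, HasImproperIntegral P 𝕜 (fun s => l0smul P 𝕜 (laplaceKernel k η s) (h s)) I :=
  exists_hasImproperIntegral hS hcont (fun ω => continuous_laplaceKernel_path k (η ω))
    (coeFn_laplaceKernel k η)
    (((measurable_decayBound k).comp (AEEqFun.stronglyMeasurable η).measurable).mul hM)
    (laplaceKernel_dominated hb k hη)

/-- Differentiation under the integral sign, with an explicit bound for the remainder. -/
lemma l0norm_slope_sub_le {h : ℝ → S} {M : Ω → ℝ}
    (hb : ∀ s, 0 ≤ s → ∀ᵐ ω ∂P, l0norm P 𝕜 (h s) ω ≤ M ω) {k : ℕ} {η y : Ω →ₘ[P] ℝ} {I₁ I₀ J : S}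
    (h₁ : HasImproperIntegral P 𝕜 (fun s => l0smul P 𝕜 (laplaceKernel k (η + y) s) (h s)) I₁)
    (h₀ : HasImproperIntegral P 𝕜 (fun s => l0smul P 𝕜 (laplaceKernel k η s) (h s)) I₀)
    (hJ : HasImproperIntegral P 𝕜 (fun s => l0smul P 𝕜 (laplaceKernel (k + 1) η s) (h s)) J)
    (hη : η ∈ L0pp P) (hy0 : ∀ᵐ ω ∂P, y ω ≠ 0) (hy : ∀ᵐ ω ∂P, |y ω| ≤ η ω / 2) :
    ∀ᵐ ω ∂P, l0norm P 𝕜 (l0smul P 𝕜 (l0Inv y) (I₁ - I₀) - J) ω ≤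
      |y ω| * (decayBound (k + 2) (η ω / 2) * M ω) * (Real.pi + 1) := by
  -- The error of the difference quotient is itself an improper integral, so an almost sure bound on
  -- its integrand suffices.
  refine (((h₁.sub h₀).l0smul (l0Inv y)).sub hJ).l0norm_le fun s hs => ?_
  have hg : l0smul P 𝕜 (l0Inv y) (l0smul P 𝕜 (laplaceKernel k (η + y) s) (h s) -
      l0smul P 𝕜 (laplaceKernel k η s) (h s)) - l0smul P 𝕜 (laplaceKernel (k + 1) η s) (h s) =
      l0smul P 𝕜 (l0Inv y * (laplaceKernel k (η + y) s - laplaceKernel k η s) -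
        laplaceKernel (k + 1) η s) (h s) := by
    rw [sub_l0smul, mul_l0smul, sub_l0smul]
  rw [hg]
  filter_upwards [hb s hs, hη, hy0, hy, l0norm_nonneg_ae P 𝕜 (h s), l0norm_l0smul_ae P 𝕜
      (l0Inv y * (laplaceKernel k (η + y) s - laplaceKernel k η s) - laplaceKernel (k + 1) η s) (h s),
    AEEqFun.coeFn_sub (l0Inv y * (laplaceKernel k (η + y) s - laplaceKernel k η s))
      (laplaceKernel (k + 1) η s),
    AEEqFun.coeFn_mul (l0Inv y) (laplaceKernel k (η + y) s - laplaceKernel k η s),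
    AEEqFun.coeFn_sub (laplaceKernel k (η + y) s) (laplaceKernel k η s), coeFn_l0Inv y,
    coeFn_laplaceKernel k (η + y) s, coeFn_laplaceKernel k η s, coeFn_laplaceKernel (k + 1) η s,
    AEEqFun.coeFn_add η y] with ω h1 h2 h3 h4 h5 e1 e2 e3 e4 e5 e6 e7 e8 e9
  rw [e1, e2, Pi.sub_apply, e3, Pi.mul_apply, e4, Pi.sub_apply, e5, e6, e7, e8, e9, Pi.add_apply]
  have h6 := (abs_slope_exp_kernel_sub_le k h3 h4 hs).trans (mul_le_mul_of_nonneg_left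
    (pow_mul_exp_neg_le_decayProfile (k + 2) (half_pos h2) hs) (abs_nonneg _))
  have h7 : 0 ≤ |y ω| * (decayBound (k + 2) (η ω / 2) * decayProfile s) :=
    mul_nonneg (abs_nonneg _) (mul_nonneg (decayBound_nonneg _ (half_pos h2))
      (decayProfile_pos s).le)
  calc _ ≤ |y ω| * (decayBound (k + 2) (η ω / 2) * decayProfile s) * M ω :=
        mul_le_mul h6 h1 h5 h7
    _ = _ := by ring

lemma exists_mem_L0pp_of_measurable {f : Ω → ℝ} (hf : Measurable f) (hpos : ∀ᵐ ω ∂P, 0 < f ω) :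
    ∃ ξ ∈ L0pp P, ∀ᵐ ω ∂P, ξ ω = f ω := by
  have h := AEEqFun.coeFn_mk (μ := P) f hf.aestronglyMeasurable
  refine ⟨AEEqFun.mk f hf.aestronglyMeasurable, ?_, h⟩
  filter_upwards [h, hpos] with ω h1 h2
  rwa [h1]

/-- The random `ε`-`δ` form of the derivative: both thresholds are positive random variables, so `δ`
may vary with the sample point. -/
lemma hasTcDerivAt_iff {G : Set (Ω →ₘ[P] ℝ)} {H : (Ω →ₘ[P] ℝ) → S} {I : S} {x₀ : Ω →ₘ[P] ℝ} :
    HasTcDerivAt P 𝕜 G H I x₀ ↔ ∀ ε ∈ L0pp P, ∃ δ ∈ L0pp P, ∀ y : Ω →ₘ[P] ℝ,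
      (∀ᵐ ω ∂P, |y ω| < δ ω) → (∀ᵐ ω ∂P, y ω ≠ 0) → x₀ + y ∈ G →
        l0smul P 𝕜 (l0Inv y) (H (x₀ + y) - H x₀) - I ∈ tcBall P 𝕜 S ε := by
  have hpp : ∀ y : Ω →ₘ[P] ℝ, l0Abs y ∈ L0pp P ↔ ∀ᵐ ω ∂P, y ω ≠ 0 := fun y => by
    refine eventually_congr ((coeFn_l0Abs y).mono fun ω h => ?_)
    rw [h, norm_pos_iff]
  have hball : ∀ (δ y : Ω →ₘ[P] ℝ),
      y ∈ tcBall P ℝ (Ω →ₘ[P] ℝ) δ ↔ ∀ᵐ ω ∂P, |y ω| < δ ω := fun δ y => by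
    refine eventually_congr ((coeFn_l0Abs y).mono fun ω h => ?_)
    change l0Abs y ω < δ ω ↔ _
    rw [h, Real.norm_eq_abs]
  constructor
  · intro h ε hε
    have hU : tcBall P 𝕜 S ε ∈ @nhds S (tcTopology P 𝕜 S) 0 :=
      mem_nhds_tc_iff.2 ⟨ε, hε, fun z hz => by rwa [zero_add]⟩
    obtain ⟨δ, hδ, hV⟩ := mem_nhds_tc_iff.1 (mem_inf_principal.1 (h hU))
    refine ⟨δ, hδ, fun y h1 h2 h3 => ?_⟩
    have h4 := hV y ((hball δ y).2 h1)
    rw [zero_add] at h4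
    exact h4 ⟨(hpp y).2 h2, h3⟩
  · intro h A hA
    obtain ⟨ε, hε, hA⟩ := mem_nhds_tc_iff.1 hA
    obtain ⟨δ, hδ, hy⟩ := h ε hε
    refine mem_inf_principal.2 (mem_nhds_tc_iff.2 ⟨δ, hδ, fun y h1 h2 => ?_⟩)
    rw [zero_add] at h2 ⊢
    have h3 := hA _ (hy y ((hball δ y).1 h1) ((hpp y).1 h2.1) h2.2)
    rwa [zero_add] at h3

lemma hasTcDerivAt_of_hasImproperIntegral {h : ℝ → S} {M : Ω → ℝ} (hM : Measurable M)
    (hb : ∀ s, 0 ≤ s → ∀ᵐ ω ∂P, l0norm P 𝕜 (h s) ω ≤ M ω) {k : ℕ} {H : (Ω →ₘ[P] ℝ) → S}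
    (hH : ∀ η ∈ L0pp P,
      HasImproperIntegral P 𝕜 (fun s => l0smul P 𝕜 (laplaceKernel k η s) (h s)) (H η))
    {η : Ω →ₘ[P] ℝ} (hη : η ∈ L0pp P) {J : S}
    (hJ : HasImproperIntegral P 𝕜 (fun s => l0smul P 𝕜 (laplaceKernel (k + 1) η s) (h s)) J) :
    HasTcDerivAt P 𝕜 (L0pp P) H J η := by
  refine hasTcDerivAt_iff.2 fun ε hε => ?_
  have hηm : Measurable η := (AEEqFun.stronglyMeasurable η).measurable
  have hεm : Measurable ε := (AEEqFun.stronglyMeasurable ε).measurable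
  set B : Ω → ℝ := fun ω => decayBound (k + 2) (η ω / 2) * M ω * (Real.pi + 1) with hB
  have hBm : Measurable B :=
    (((measurable_decayBound (k + 2)).comp (hηm.div_const 2)).mul hM).mul_const _
  have hB0 : ∀ᵐ ω ∂P, 0 ≤ B ω := by
    filter_upwards [hη, hb 0 le_rfl, l0norm_nonneg_ae P 𝕜 (h 0)] with ω h1 h2 h3
    exact mul_nonneg (mul_nonneg (decayBound_nonneg _ (half_pos h1)) (h3.trans h2))
      (by positivity)
  -- The first entry keeps half of the decay rate `η`; the second makes `|y| (B + 1) < ε`, where the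
  -- `+ 1` allows `B` to vanish.
  obtain ⟨δ, hδ, hδe⟩ := exists_mem_L0pp_of_measurable (P := P)
    (f := fun ω => min (η ω / 2) (ε ω / (B ω + 1)))
    ((hηm.div_const 2).min (hεm.div (hBm.add_const 1))) (by
      filter_upwards [hη, hε, hB0] with ω h1 h2 h3
      exact lt_min (half_pos h1) (by positivity))
  refine ⟨δ, hδ, fun y hyδ hy0 hyG => ?_⟩
  have hyη : ∀ᵐ ω ∂P, |y ω| ≤ η ω / 2 := by
    filter_upwards [hyδ, hδe] with ω h1 h2
    exact h1.le.trans (h2.le.trans (min_le_left _ _))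
  filter_upwards [l0norm_slope_sub_le hb (hH _ hyG) (hH _ hη) hJ hη hy0 hyη, hB0, hyδ, hδe]
    with ω h1 h2 h3 h4
  have h5 : |y ω| < ε ω / (B ω + 1) := h3.trans_le (h4.le.trans (min_le_right _ _))
  rw [lt_div_iff₀ (by positivity)] at h5
  refine h1.trans_lt (lt_of_le_of_lt ?_ h5)
  rw [mul_assoc]
  exact mul_le_mul_of_nonneg_left (by rw [hB]; simp) (abs_nonneg _)

/-- For `η` in `L⁰₊₊` admissible increments of arbitrarily small random size exist, for instance
half the minimum of the two thresholds. A common difference quotient is then close to both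
candidates. -/
lemma HasTcDerivAt.unique {H : (Ω →ₘ[P] ℝ) → S} {I I' : S} {η : Ω →ₘ[P] ℝ} (hη : η ∈ L0pp P)
    (h : HasTcDerivAt P 𝕜 (L0pp P) H I η) (h' : HasTcDerivAt P 𝕜 (L0pp P) H I' η) : I = I' := by
  refine eq_of_l0norm_sub_ae_le (P := P) (𝕜 := 𝕜) fun ε hε => ?_
  obtain ⟨δ, hδ, hy⟩ := hasTcDerivAt_iff.1 h _ (l0const_mem_L0pp (half_pos hε))
  obtain ⟨δ', hδ', hy'⟩ := hasTcDerivAt_iff.1 h' _ (l0const_mem_L0pp (half_pos hε))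
  have hδm : Measurable δ := (AEEqFun.stronglyMeasurable δ).measurable
  have hδm' : Measurable δ' := (AEEqFun.stronglyMeasurable δ').measurable
  obtain ⟨y, hypos, hye⟩ := exists_mem_L0pp_of_measurable (P := P) ((hδm.min hδm').div_const 2)
    (by filter_upwards [hδ, hδ'] with ω h h' using half_pos (lt_min h h'))
  have hyabs : ∀ᵐ ω ∂P, |y ω| < δ ω ∧ |y ω| < δ' ω := by
    filter_upwards [hypos, hye, hδ, hδ'] with ω h1 h2 h3 h4
    have h5 := half_lt_self (lt_min h3 h4)
    rw [abs_of_pos h1, h2]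
    exact lt_min_iff.1 h5
  have hy0 : ∀ᵐ ω ∂P, y ω ≠ 0 := by
    filter_upwards [hypos] with ω h using ne_of_gt h
  have hηy : η + y ∈ L0pp P := by
    filter_upwards [hη, hypos, AEEqFun.coeFn_add η y] with ω h1 h2 h3
    rw [h3]
    exact add_pos h1 h2
  set q := l0smul P 𝕜 (l0Inv y) (H (η + y) - H η)
  filter_upwards [hy y (hyabs.mono fun _ h => h.1) hy0 hηy,
    hy' y (hyabs.mono fun _ h => h.2) hy0 hηy, coeFn_l0const P (ε / 2),
    l0norm_sub_le_ae P 𝕜 I q I', l0norm_sub_comm_ae P 𝕜 I q] with ω h1 h2 h3 h4 h5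
  rw [h3] at h1 h2
  linarith

lemma hasLaplaceTransformAt_iff {h : ℝ → S} {η : Ω →ₘ[P] ℝ} {I : S} :
    HasLaplaceTransformAt P 𝕜 h η I ↔
      HasImproperIntegral P 𝕜 (fun s => l0smul P 𝕜 (laplaceKernel 0 η s) (h s)) I := by
  simp only [laplaceKernel_zero]
  rfl

lemma hasLaplaceTransformAt_laplaceTransform {h : ℝ → S} {η : Ω →ₘ[P] ℝ}
    (H : ∃ I : S, HasLaplaceTransformAt P 𝕜 h η I) :
    HasLaplaceTransformAt P 𝕜 h η (laplaceTransform P 𝕜 h η) := by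
  rw [laplaceTransform, dif_pos H]
  exact H.choose_spec

lemma hasTcDerivAt_tcDeriv {G : Set (Ω →ₘ[P] ℝ)} {H : (Ω →ₘ[P] ℝ) → S} {η : Ω →ₘ[P] ℝ}
    (h : ∃ I : S, HasTcDerivAt P 𝕜 G H I η) :
    HasTcDerivAt P 𝕜 G H (tcDeriv P 𝕜 G H η) η := by
  rw [tcDeriv, dif_pos h]
  exact h.choose_spec

/-- The iterated `T_c`-derivatives of the Laplace transform are the integrals of
`(-s) ^ k e^{-η s} h(s)`. -/
lemma hasImproperIntegral_iterTcDeriv (hS : EpsLambdaComplete P 𝕜 S) {h : ℝ → S}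
    (hcont : @ContinuousOn ℝ S _ (epsLambdaTopology P 𝕜 S) h (Set.Ici 0)) {M : Ω → ℝ}
    (hM : Measurable M) (hb : ∀ s, 0 ≤ s → ∀ᵐ ω ∂P, l0norm P 𝕜 (h s) ω ≤ M ω) (k : ℕ) :
    ∀ η ∈ L0pp P, HasImproperIntegral P 𝕜 (fun s => l0smul P 𝕜 (laplaceKernel k η s) (h s))
      (iterTcDeriv P 𝕜 (L0pp P) (laplaceTransform P 𝕜 h) k η) := by
  induction k with
  | zero =>
    intro η hη
    obtain ⟨I, hI⟩ := exists_hasImproperIntegral_laplaceKernel hS hcont hM hb 0 hη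
    exact hasLaplaceTransformAt_iff.1
      (hasLaplaceTransformAt_laplaceTransform ⟨I, hasLaplaceTransformAt_iff.2 hI⟩)
  | succ k ih =>
    intro η hη
    obtain ⟨J, hJ⟩ := exists_hasImproperIntegral_laplaceKernel hS hcont hM hb (k + 1) hη
    have h1 := hasTcDerivAt_of_hasImproperIntegral hM hb ih hη hJ
    have h2 := hasTcDerivAt_tcDeriv ⟨J, h1⟩
    -- The iterated derivative is a chosen one; uniqueness identifies it with the integral `J`,
    -- which lets the induction continue.
    rw [iterTcDeriv, ← h1.unique hη h2]
    exact hJ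

lemma hasTcDerivAt_iterTcDeriv (hS : EpsLambdaComplete P 𝕜 S) {h : ℝ → S}
    (hcont : @ContinuousOn ℝ S _ (epsLambdaTopology P 𝕜 S) h (Set.Ici 0)) {M : Ω → ℝ}
    (hM : Measurable M) (hb : ∀ s, 0 ≤ s → ∀ᵐ ω ∂P, l0norm P 𝕜 (h s) ω ≤ M ω) (k : ℕ)
    {η : Ω →ₘ[P] ℝ} (hη : η ∈ L0pp P) :
    HasTcDerivAt P 𝕜 (L0pp P) (iterTcDeriv P 𝕜 (L0pp P) (laplaceTransform P 𝕜 h) k)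
      (iterTcDeriv P 𝕜 (L0pp P) (laplaceTransform P 𝕜 h) (k + 1) η) η :=
  hasTcDerivAt_of_hasImproperIntegral hM hb (hasImproperIntegral_iterTcDeriv hS hcont hM hb k) hη
    (hasImproperIntegral_iterTcDeriv hS hcont hM hb (k + 1) η hη)

end LaplaceDerivatives

/-! ### Concentration of gamma densities in a Banach space. -/

section GammaDensity

lemma integral_pow_mul_exp_neg (m : ℕ) {r : ℝ} (hr : 0 < r) :
    ∫ s in Set.Ioi (0 : ℝ), s ^ m * Real.exp (-(s * r)) = m.factorial / r ^ (m + 1) := by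
  have h := Real.integral_rpow_mul_exp_neg_mul_Ioi (a := m + 1) (by positivity) hr
  rw [Real.Gamma_nat_eq_factorial, one_div, Real.inv_rpow hr.le] at h
  have h2 : r ^ ((m : ℝ) + 1) = r ^ (m + 1) := by exact_mod_cast Real.rpow_natCast r (m + 1)
  rw [h2, inv_mul_eq_div] at h
  rw [← h]
  refine setIntegral_congr_fun measurableSet_Ioi fun s _ => ?_
  simp only [add_sub_cancel_right, Real.rpow_natCast, mul_comm s r]

/-- A non-integrable function has integral `0` by convention, whereas the computed value is
positive. -/
lemma integrableOn_pow_mul_exp_neg (m : ℕ) {r : ℝ} (hr : 0 < r) :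
    IntegrableOn (fun s : ℝ => s ^ m * Real.exp (-(s * r))) (Set.Ioi 0) := by
  by_contra h
  have h1 := integral_pow_mul_exp_neg m hr
  rw [integral_undef h] at h1
  have : (0 : ℝ) < m.factorial / r ^ (m + 1) := by positivity
  exact this.ne h1

variable {E : Type*} [NormedAddCommGroup E] [NormedSpace ℝ E]

lemma integrableOn_pow_mul_exp_neg_smul {f : ℝ → E} (hf : ContinuousOn f (Set.Ici 0)) {C : ℝ}
    (hC : ∀ s, 0 ≤ s → ‖f s‖ ≤ C) (m : ℕ) {r : ℝ} (hr : 0 < r) :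
    IntegrableOn (fun s : ℝ => (s ^ m * Real.exp (-(s * r))) • f s) (Set.Ioi 0) := by
  refine Integrable.smul_bdd (integrableOn_pow_mul_exp_neg m hr) C
    ((hf.mono Set.Ioi_subset_Ici_self).aestronglyMeasurable measurableSet_Ioi) ?_
  filter_upwards [ae_restrict_mem measurableSet_Ioi] with s hs using hC s (le_of_lt hs)

/-- The gamma densities with mean `(k + 1) t / k` and shape `k + 1` concentrate at `t`. -/
lemma tendsto_integral_gamma_smul [CompleteSpace E] {f : ℝ → E}
    (hf : ContinuousOn f (Set.Ici 0)) {C : ℝ} (hC : ∀ s, 0 ≤ s → ‖f s‖ ≤ C) {t : ℝ} (ht : 0 < t) :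
    Tendsto (fun k : ℕ => (((k : ℝ) / t) ^ (k + 1) * (1 / (k.factorial : ℝ))) •
      ∫ s in Set.Ioi (0 : ℝ), (s ^ k * Real.exp (-(s * ((k : ℝ) / t)))) • f s)
      atTop (nhds (f t)) := by
  have hC0 : 0 ≤ C := (norm_nonneg _).trans (hC 0 le_rfl)
  rw [Metric.tendsto_atTop']
  intro ε hε
  obtain ⟨δ, hδ, hcont⟩ := Metric.continuousOn_iff.1 hf t ht.le (ε / 2) (half_pos hε)
  -- Chebyshev's constant: away from `t` the trivial bound `2 C` is at most `D (s - t)²`, so one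
  -- quadratic majorant works for all `s ≥ 0`.
  set D : ℝ := 2 * C / δ ^ 2 with hD
  have hpt : ∀ s, 0 ≤ s → ‖f s - f t‖ ≤ ε / 2 + D * (s - t) ^ 2 := by
    intro s hs
    by_cases hst : dist s t < δ
    · have h1 := hcont s hs hst
      rw [dist_eq_norm] at h1
      have : 0 ≤ D * (s - t) ^ 2 := by positivity
      linarith
    · have h1 : δ ^ 2 ≤ (s - t) ^ 2 := by
        rw [← sq_abs (s - t), ← Real.dist_eq]
        exact pow_le_pow_left₀ hδ.le (not_lt.1 hst) 2
      have h2 : 2 * C ≤ D * (s - t) ^ 2 := by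
        rw [hD, div_mul_eq_mul_div, le_div_iff₀ (by positivity)]
        exact mul_le_mul_of_nonneg_left h1 (by positivity)
      have h3 := norm_sub_le (f s) (f t)
      linarith [hC s hs, hC t ht.le]
  -- The factor of `D` is the second moment about `t`: variance `(k + 1) t² / k²` plus squared bias
  -- `t² / k²`.
  have hlim : Tendsto (fun k : ℕ => D * (t ^ 2 * (1 / (k : ℝ) + 2 * (1 / (k : ℝ)) ^ 2))) atTop
      (nhds 0) := by
    have h1 := tendsto_one_div_atTop_nhds_zero_nat (𝕜 := ℝ)
    simpa using ((h1.add ((h1.pow 2).const_mul 2)).const_mul (t ^ 2)).const_mul D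
  obtain ⟨K, hK⟩ := eventually_atTop.1 (hlim.eventually_lt_const (half_pos hε))
  refine ⟨K, fun k hk => ?_⟩
  have hk0 : (0 : ℝ) < k := by exact_mod_cast Nat.zero_lt_of_lt hk
  set r : ℝ := (k : ℝ) / t with hr
  have hr0 : 0 < r := div_pos hk0 ht
  set c : ℝ := r ^ (k + 1) * (1 / (k.factorial : ℝ)) with hc
  have hc0 : 0 < c := by positivity
  have hi := fun m => integrableOn_pow_mul_exp_neg m hr0
  have hmass : c * ∫ s in Set.Ioi (0 : ℝ), s ^ k * Real.exp (-(s * r)) = 1 := by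
    rw [integral_pow_mul_exp_neg k hr0, hc]
    field_simp
  have hrepr : c • (∫ s in Set.Ioi (0 : ℝ), (s ^ k * Real.exp (-(s * r))) • f s) - f t =
      c • ∫ s in Set.Ioi (0 : ℝ), (s ^ k * Real.exp (-(s * r))) • (f s - f t) := by
    simp only [smul_sub]
    rw [integral_sub (integrableOn_pow_mul_exp_neg_smul hf hC k hr0) ((hi k).smul_const _),
      integral_smul_const, smul_sub, smul_smul, hmass, one_smul]
  -- Expanding the square reduces everything to the moments of orders `k`, `k + 1` and `k + 2`,
  -- which are explicit factorials.
  have hexpand : ∀ s : ℝ, s ^ k * Real.exp (-(s * r)) * (ε / 2 + D * (s - t) ^ 2) =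
      (ε / 2 + D * t ^ 2) * (s ^ k * Real.exp (-(s * r))) -
        2 * D * t * (s ^ (k + 1) * Real.exp (-(s * r))) +
        D * (s ^ (k + 2) * Real.exp (-(s * r))) := fun s => by ring
  have hint : IntegrableOn
      (fun s : ℝ => s ^ k * Real.exp (-(s * r)) * (ε / 2 + D * (s - t) ^ 2)) (Set.Ioi 0) := by
    simp only [hexpand]
    exact (((hi k).const_mul _).sub ((hi (k + 1)).const_mul _)).add ((hi (k + 2)).const_mul _)
  have hval : c * ∫ s in Set.Ioi (0 : ℝ), s ^ k * Real.exp (-(s * r)) *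
      (ε / 2 + D * (s - t) ^ 2) = ε / 2 + D * (t ^ 2 * (1 / (k : ℝ) + 2 * (1 / (k : ℝ)) ^ 2)) := by
    simp only [hexpand]
    have hi₀ : IntegrableOn (fun s : ℝ => (ε / 2 + D * t ^ 2) * (s ^ k * Real.exp (-(s * r))) -
        2 * D * t * (s ^ (k + 1) * Real.exp (-(s * r)))) (Set.Ioi 0) :=
      ((hi k).const_mul _).sub ((hi (k + 1)).const_mul _)
    rw [integral_add hi₀ ((hi (k + 2)).const_mul _), integral_sub ((hi k).const_mul _) ((hi (k + 1)).const_mul _),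
      integral_const_mul, integral_const_mul, integral_const_mul, integral_pow_mul_exp_neg k hr0,
      integral_pow_mul_exp_neg (k + 1) hr0, integral_pow_mul_exp_neg (k + 2) hr0, hc,
      Nat.factorial_succ (k + 1), Nat.factorial_succ k]
    have hf0 : (k.factorial : ℝ) ≠ 0 := by positivity
    -- Eliminating `t` turns the identity into a rational one in `k` and `r`.
    have hrt : t = k / r := by rw [hr]; field_simp
    rw [hrt]
    push_cast
    field_simp
    ring
  rw [dist_eq_norm, hrepr, norm_smul, Real.norm_of_nonneg hc0.le]
  calc c * ‖∫ s in Set.Ioi (0 : ℝ), (s ^ k * Real.exp (-(s * r))) • (f s - f t)‖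
      ≤ c * ∫ s in Set.Ioi (0 : ℝ), s ^ k * Real.exp (-(s * r)) * (ε / 2 + D * (s - t) ^ 2) := by
        refine mul_le_mul_of_nonneg_left (norm_integral_le_of_norm_le hint ?_) hc0.le
        filter_upwards [ae_restrict_mem measurableSet_Ioi] with s hs
        have hs0 : (0 : ℝ) ≤ s := le_of_lt hs
        rw [norm_smul, Real.norm_of_nonneg (by positivity)]
        exact mul_le_mul_of_nonneg_left (hpt s hs0) (by positivity)
    _ = _ := hval
    _ < ε := by linarith [hK k hk.le]

end GammaDensity

/-! ### The inversion formula. -/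

section PostWidder

variable {Ω : Type*} [MeasurableSpace Ω] {P : Measure Ω} [IsProbabilityMeasure P] {𝕜 : Type*}
  [RCLike 𝕜] {S : Type*} [AddCommGroup S] [Module (Ω →ₘ[P] 𝕜) S] [RandomNormedModule P 𝕜 S]

lemma laplaceKernel_const (k : ℕ) (r s : ℝ) :
    laplaceKernel k (AEEqFun.const Ω r : Ω →ₘ[P] ℝ) s =
      AEEqFun.const Ω ((-1) ^ k * (s ^ k * Real.exp (-(s * r)))) := by
  refine AEEqFun.ext ?_
  filter_upwards [coeFn_laplaceKernel k (AEEqFun.const Ω r : Ω →ₘ[P] ℝ) s, coeFn_l0const P r,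
    coeFn_l0const P ((-1) ^ k * (s ^ k * Real.exp (-(s * r))))] with ω h1 h2 h3
  rw [h1, h2, h3, neg_pow, mul_assoc]

lemma l0smul_one (x : S) : l0smul P 𝕜 1 x = x := by
  rw [l0smul_eq_hom, map_one, one_smul]

/-- The Post–Widder inversion formula, for the iterated derivatives as integrals. -/
lemma tendsto_postWidder (hS : EpsLambdaComplete P 𝕜 S) {h : ℝ → S}
    (hcont : @ContinuousOn ℝ S _ (epsLambdaTopology P 𝕜 S) h (Set.Ici 0)) {M : Ω → ℝ}
    (hM : Measurable M) (hb : ∀ s, 0 ≤ s → ∀ᵐ ω ∂P, l0norm P 𝕜 (h s) ω ≤ M ω)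
    {L : ℕ → (Ω →ₘ[P] ℝ) → S} (hL : ∀ k, ∀ η ∈ L0pp P,
      HasImproperIntegral P 𝕜 (fun s => l0smul P 𝕜 (laplaceKernel k η s) (h s)) (L k η))
    {t : ℝ} (ht : 0 < t) :
    Tendsto (fun k : ℕ => rsmul P 𝕜 ((-1) ^ k * ((k : ℝ) / t) ^ (k + 1) *
      (1 / (k.factorial : ℝ))) (L k (AEEqFun.const Ω ((k : ℝ) / t))))
      atTop (@nhds S (epsLambdaTopology P 𝕜 S) (h t)) := by
  set w := RandomWeight.of M hM
  have hw : Integrable (fun ω => w.toFun ω * M ω) P := RandomWeight.integrable_of M hM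
  have := WeightedL1.completeSpace (w := w) hS
  -- With the constant kernel `1`, `h` itself is lifted; one weight then serves all `k`, because the
  -- kernels at `k / t` are deterministic.
  obtain ⟨G, hG, hGv⟩ := WeightedL1.exists_continuousOn_lift (w := w) hcont
    (κ := fun _ => 1) (k := fun _ _ => 1) (fun _ => continuous_const)
    (fun _ => AEEqFun.coeFn_one (α := Ω) (μ := P) (β := ℝ)) hw
    (fun s hs => by rw [l0smul_one]; exact hb s hs)
  simp only [l0smul_one] at hGv
  have hbound : ∀ s, 0 ≤ s → ‖G s‖ ≤ ∫ ω, w.toFun ω * M ω ∂P := fun s hs =>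
    WeightedL1.norm_le_of_ae_le (by rw [hGv s hs]; exact hb s hs) hw
  have hlim := WeightedL1.tendsto_val (tendsto_integral_gamma_smul hG hbound ht)
  rw [hGv t ht.le] at hlim
  refine hlim.congr' ?_
  -- For `k = 0` the point `k / t` lies outside `L⁰₊₊`, so that term carries no information.
  filter_upwards [eventually_gt_atTop 0] with k hk
  have hr : 0 < (k : ℝ) / t := div_pos (by exact_mod_cast hk) ht
  set r := (k : ℝ) / t
  set I := ∫ s in Set.Ioi (0 : ℝ), (s ^ k * Real.exp (-(s * r))) • G s with hI
  have h1 : HasImproperIntegral P 𝕜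
      (fun s => l0smul P 𝕜 (laplaceKernel k (AEEqFun.const Ω r) s) (h s)) (((-1 : ℝ) ^ k) • I).val := by
    have h2 := (integrableOn_pow_mul_exp_neg_smul hG hbound k hr).smul ((-1 : ℝ) ^ k)
    rw [hI, ← integral_smul]
    have hk : Continuous fun s : ℝ => s ^ k * Real.exp (-(s * r)) := by fun_prop
    refine WeightedL1.hasImproperIntegral hS ?_ (fun s hs => ?_) h2
    · exact (hk.continuousOn.smul hG).const_smul ((-1 : ℝ) ^ k)
    · rw [smul_smul, WeightedL1.val_smul, hGv s hs, laplaceKernel_const, rsmul]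
  rw [(hL k _ (l0const_mem_L0pp hr)).unique h1, ← WeightedL1.val_smul, smul_smul]
  congr 2
  have h3 : ((-1 : ℝ) ^ k) * (-1) ^ k = 1 := by rw [← mul_pow]; simp
  linear_combination (-(r ^ (k + 1) * (1 / (k.factorial : ℝ)))) * h3

end PostWidder

theorem theorem3p5 {Ω : Type*} [MeasurableSpace Ω] (P : Measure Ω) [IsProbabilityMeasure P]
    (𝕜 : Type*) [RCLike 𝕜] {S : Type*} [AddCommGroup S] [Module (Ω →ₘ[P] 𝕜) S]
    [RandomNormedModule P 𝕜 S] (hS : EpsLambdaComplete P 𝕜 S)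
    (h : ℝ → S) (hcont : @ContinuousOn ℝ S _ (epsLambdaTopology P 𝕜 S) h (Set.Ici 0))
    (M : Ω →ₘ[P] ℝ) (hM : 0 ≤ M) (hbound : ∀ s : ℝ, 0 ≤ s → l0norm P 𝕜 (h s) ≤ M) :
    (∀ η ∈ L0pp P, HasLaplaceTransformAt P 𝕜 h η (laplaceTransform P 𝕜 h η)) ∧
    (∀ (k : ℕ), ∀ η ∈ L0pp P,
      HasTcDerivAt P 𝕜 (L0pp P) (iterTcDeriv P 𝕜 (L0pp P) (laplaceTransform P 𝕜 h) k)
        (iterTcDeriv P 𝕜 (L0pp P) (laplaceTransform P 𝕜 h) (k + 1) η) η) ∧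
    ∀ t : ℝ, 0 < t →
      Tendsto
        (fun k : ℕ => rsmul P 𝕜 ((-1) ^ k * ((k : ℝ) / t) ^ (k + 1) * (1 / (k.factorial : ℝ)))
          (iterTcDeriv P 𝕜 (L0pp P) (laplaceTransform P 𝕜 h) k
            (AEEqFun.const Ω ((k : ℝ) / t))))
        atTop (@nhds S (epsLambdaTopology P 𝕜 S) (h t)) := by
  have hMm : Measurable M := (AEEqFun.stronglyMeasurable M).measurable
  have hb : ∀ s, 0 ≤ s → ∀ᵐ ω ∂P, l0norm P 𝕜 (h s) ω ≤ M ω := fun s hs =>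
    AEEqFun.coeFn_le.2 (hbound s hs)
  have hint := hasImproperIntegral_iterTcDeriv hS hcont hMm hb
  exact ⟨fun η hη => hasLaplaceTransformAt_iff.2 (hint 0 η hη),
    fun k η hη => hasTcDerivAt_iterTcDeriv hS hcont hMm hb k hη,
    fun t ht => tendsto_postWidder hS hcont hMm hb hint ht⟩
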